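/- **Model.** Let $e_3\in\mathbb R^3$ be the third vector of an inertial frame, pointing downward along gravity $g$. A rigid payload (mass $m_0$, symmetric inertia matrix $J_0$, mass center $x_0\in\mathbb R^3$, attitude $R_0\in SO(3)$) is carried by $n$ quadrotors (masses $m_i$, symmetric inertia matrices $J_i$, attitudes $R_i\in SO(3)$). The $i$-th quadrotor is connected to the point $\rho_i\in\mathbb R^3$ of the payload (body-fixed frame, measured from the mass center) by a cable of $n_i$ serial links with masses $m_{ij}$, lengths $l_{ij}>0$ and directions $q_{ij}\in S^2$, numbered from the quadrotor toward the payload. The configuration manifold is $SO(3)\times\mathbb R^3\times SO(3)^n\times(S^2)^{\sum_i n_i}$. The hat map is $\hat x y=x\times y$; the angular velocities are defined by $\dot R_0=R_0\hat\Omega_0$, $\dot R_i=R_i\hat\Omega_i$. The positions of the $i$-th quadrotor and of the $j$-th link of its cable are $$x_i=x_0+R_0\rho_i-\sum_{a=1}^{n_i}l_{ia}q_{ia},\qquad x_{ij}=x_0+R_0\rho_i-\sum_{a=j+1}^{n_i}l_{ia}q_{ia}.$$ The Lagrangian is $L=T-V$ with $$T=\tfrac12m_0\|\dot x_0\|^2+\sum_{i,j}\tfrac12m_{ij}\|\dot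 x_{ij}\|^2+\tfrac12\sum_i m_i\|\dot x_i\|^2+\tfrac12\sum_i\Omega_i\cdot J_i\Omega_i+\tfrac12\Omega_0\cdot J_0\Omega_0,$$ $$V=-m_0ge_3\cdot x_0-\sum_i m_ige_3\cdot x_i-\sum_{i,j}m_{ij}ge_3\cdot x_{ij}.$$ The $i$-th quadrotor generates the thrust $-f_iR_ie_3$ (inertial frame) and the moment $M_i$ (its body-fixed frame), where $f_i$ and $M_i$ are continuous functions of time on $[t_0,t_f]$, $t_0<t_f$. A $C^2$ motion satisfies the Lagrange–d'Alembert (Hamilton) principle on $[t_0,t_f]$ if for every $C^2$ variation of it in the configuration manifold with fixed end points $$\delta\int_{t_0}^{t_f}L\,dt=-\int_{t_0}^{t_f}\sum_{i=1}^n\big(-f_iR_ie_3\cdot\delta x_i+M_i\cdot\eta_i\big)\,dt,\qquad \delta R_i=R_i\hat\eta_i .$$ **Proposition.** Put $M_{iT}=\sum_{j=1}^{n_i}m_{ij}+m_i$, $M_T=m_0+\sum_iM_{iT}$, $M_{0ij}=m_i+\sum_{a=1}^{j-1}m_{ia}$, $\bar J_0=J_0-\sum_iM_{iT}\hat\rho_i^2$,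 and $j\wedge k=\min(j,k)$. A $C^2$ motion satisfies the Lagrange–d'Alembert principle on $[t_0,t_f]$ if and only if, at all $t\in[t_0,t_f]$ and for all $i,j$, $$M_T\ddot x_0-\sum_{i,j}M_{0ij}l_{ij}\ddot q_{ij}-\sum_iM_{iT}R_0\hat\rho_i\dot\Omega_0=M_Tge_3-\sum_if_iR_ie_3-\sum_iM_{iT}R_0\hat\Omega_0^2\rho_i,$$ $$\bar J_0\dot\Omega_0+\sum_iM_{iT}\hat\rho_iR_0^T\ddot x_0-\sum_{i,j}M_{0ij}l_{ij}\hat\rho_iR_0^T\ddot q_{ij}=\sum_i\hat\rho_iR_0^T(-f_iR_ie_3+M_{iT}ge_3)-\hat\Omega_0\bar J_0\Omega_0,$$ $$\sum_{k=1}^{n_i}M_{0i(j\wedge k)}l_{ik}\hat q_{ij}^2\ddot q_{ik}-M_{0ij}\hat q_{ij}^2\ddot x_0+M_{0ij}\hat q_{ij}^2R_0\hat\rho_i\dot\Omega_0=M_{0ij}\hat q_{ij}^2R_0\hat\Omega_0^2\rho_i-\hat q_{ij}^2(M_{0ij}ge_3-f_iR_ie_3),$$ $$J_i\dot\Omega_i+\Omega_i\times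 J_i\Omega_i=M_i.$$ Moreover, along every $C^2$ motion, at each time $t\in[t_0,t_f]$ the first three groups of equations hold if and only if $\mathbf N\ddot X=\mathbf P$, where $\ddot X=[\ddot x_0,\dot\Omega_0,\ddot q_{1j},\dots,\ddot q_{nj}]^T\in\mathbb R^{D_X}$, $D_X=6+3\sum_in_i$, $$\mathbf N=\begin{bmatrix}M_TI_3&\mathbf N_{x_0\Omega_0}&\mathbf N_{x_01}&\cdots&\mathbf N_{x_0n}\\ \mathbf N_{\Omega_0x_0}&\bar J_0&\mathbf N_{\Omega_01}&\cdots&\mathbf N_{\Omega_0n}\\ \mathbf N_{1x_0}&\mathbf N_{1\Omega_0}&\mathbf N_{qq1}&\cdots&0\\ \vdots&\vdots&\vdots&\ddots&\vdots\\ \mathbf N_{nx_0}&\mathbf N_{n\Omega_0}&0&\cdots&\mathbf N_{qqn}\end{bmatrix},$$ $\mathbf N_{x_0\Omega_0}=-\sum_iM_{iT}R_0\hat\rho_i$, $\mathbf N_{\Omega_0x_0}=\mathbf N_{x_0\Omega_0}^T$; $\mathbf N_{x_0i}$ and $\mathbf N_{\Omega_0i}$ are block rows with $j$-th blocks $-M_{0ij}l_{ij}I_3$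 and $-M_{0ij}l_{ij}\hat\rho_iR_0^T$; $\mathbf N_{ix_0}$ and $\mathbf N_{i\Omega_0}$ are block columns with $j$-th blocks $-M_{0ij}\hat q_{ij}^2$ and $M_{0ij}\hat q_{ij}^2R_0\hat\rho_i$; $\mathbf N_{qqi}$ has the diagonal blocks $-M_{0ij}l_{ij}I_3$ and, in block row $j$ and block column $k\neq j$, the block $M_{0i(j\wedge k)}l_{ik}\hat q_{ij}^2$; and $\mathbf P=[P_{x_0},P_{\Omega_0},P_{1j},\dots,P_{nj}]^T$ with $$P_{x_0}=M_Tge_3-\sum_if_iR_ie_3-\sum_iM_{iT}R_0\hat\Omega_0^2\rho_i,\qquad P_{\Omega_0}=-\hat\Omega_0\bar J_0\Omega_0+\sum_i\hat\rho_iR_0^T(M_{iT}ge_3-f_iR_ie_3),$$ $$P_{ij}=-\hat q_{ij}^2(-f_iR_ie_3+M_{0ij}ge_3)+M_{0ij}\hat q_{ij}^2R_0\hat\Omega_0^2\rho_i+M_{0ij}l_{ij}\|\dot q_{ij}\|^2q_{ij}.$$ -/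

import Mathlib

open scoped Matrix

namespace CableTransport

/-- Vectors of `ℝ³`; the inner product is the dot product `⬝ᵥ`, and `‖v‖² = v ⬝ᵥ v`. -/
abbrev V3 : Type := Fin 3 → ℝ

/-- Real `3 × 3` matrices. -/
abbrev Mat3 : Type := Matrix (Fin 3) (Fin 3) ℝ

/-- The rotation group `SO(3)`. -/
abbrev SO3 : Type := Matrix.specialOrthogonalGroup (Fin 3) ℝ

/-- The two-sphere of unit vectors of `ℝ³`. -/
abbrev S2 : Type := {q : V3 // q ⬝ᵥ q = 1}

/-- The third vector of the inertial frame; it points downward, along gravity. -/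
def e3 : V3 := ![0, 0, 1]

/-- The hat map `ℝ³ → so(3)`. -/
def hat (v : V3) : Mat3 :=
  !![0, -v 2, v 1;
     v 2, 0, -v 0;
     -v 1, v 0, 0]

/-- The vee map, the inverse of the hat map on skew-symmetric matrices. -/
def vee (A : Mat3) : V3 := ![A 2 1, A 0 2, A 1 0]

theorem hat_mulVec (v w : V3) : hat v *ᵥ w = v ⨯₃ w := by
  ext a
  fin_cases a <;> simp [hat, cross_apply, Matrix.mulVec, dotProduct, Fin.sum_univ_three] <;> ring

theorem vee_hat (v : V3) : vee (hat v) = v := by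
  ext a
  fin_cases a <;> simp [hat, vee]

theorem hat_vee (A : Mat3) (hA : Aᵀ = -A) : hat (vee A) = A := by
  have h : ∀ a b, A b a = -A a b := fun a b => by
    simpa using congrFun (congrFun hA a) b
  ext a b
  fin_cases a <;> fin_cases b <;> simp [hat, vee] <;>
    linarith [h 0 0, h 1 1, h 2 2, h 0 1, h 0 2, h 1 2]

/-- Entrywise derivative of a matrix-valued function of a real variable. -/
noncomputable def matDeriv (A : ℝ → Mat3) (t : ℝ) : Mat3 :=
  Matrix.of fun a b => deriv (fun s => A s a b) t

/-- The body-fixed velocity of a curve in `SO(3)`: the vector `Ω` with `Ṙ = R Ω̂`. -/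
noncomputable def bodyVel (R : ℝ → SO3) (t : ℝ) : V3 :=
  vee ((R t : Mat3)ᵀ * matDeriv (fun s => (R s : Mat3)) t)

/-- The physical constants of `n` quadrotors that carry a rigid payload, where the cable of the
`i`-th quadrotor consists of `nl i` links. The links of a cable are numbered outward from the
quadrotor toward the payload. -/
structure System (n : ℕ) (nl : Fin n → ℕ) where
  /-- mass of the payload -/
  m0 : ℝ
  /-- moment of inertia of the payload -/
  J0 : Mat3
  /-- masses of the quadrotors -/
  m : Fin n → ℝ
  /-- moments of inertia of the quadrotors -/
  J : Fin n → Mat3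
  /-- points of the payload (in its body-fixed frame, from its mass center) where the cables are
  attached -/
  ρ : Fin n → V3
  /-- masses of the links -/
  mL : (i : Fin n) → Fin (nl i) → ℝ
  /-- lengths of the links -/
  l : (i : Fin n) → Fin (nl i) → ℝ
  /-- gravitational acceleration -/
  g : ℝ

/-- The configuration manifold `SO(3) × ℝ³ × SO(3)ⁿ × (S²)^(∑ nᵢ)`. -/
structure Config (n : ℕ) (nl : Fin n → ℕ) where
  /-- attitude of the payload -/
  R0 : SO3
  /-- position of the mass center of the payload -/
  x0 : V3
  /-- attitudes of the quadrotors -/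
  R : Fin n → SO3
  /-- directions of the links -/
  q : (i : Fin n) → Fin (nl i) → S2

/-- A map from a normed space to the configuration manifold is of class `C²`. -/
structure IsC2 {n : ℕ} {nl : Fin n → ℕ} {E : Type*} [NormedAddCommGroup E] [NormedSpace ℝ E]
    (F : E → Config n nl) : Prop where
  R0 : ∀ a b, ContDiff ℝ 2 fun p => ((F p).R0 : Mat3) a b
  x0 : ContDiff ℝ 2 fun p => (F p).x0
  R : ∀ i a b, ContDiff ℝ 2 fun p => ((F p).R i : Mat3) a b
  q : ∀ i j, ContDiff ℝ 2 fun p => ((F p).q i j : V3)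

/-- A variation with fixed end points of the curve `c` over `[t0, tf]`: a `C²` family of curves
`γ ε` in the configuration manifold that starts at `c`. -/
structure IsVariation {n : ℕ} {nl : Fin n → ℕ} (t0 tf : ℝ) (c : ℝ → Config n nl)
    (γ : ℝ → ℝ → Config n nl) : Prop where
  isC2 : IsC2 fun p : ℝ × ℝ => γ p.1 p.2
  zero : γ 0 = c
  left : ∀ ε, γ ε t0 = c t0
  right : ∀ ε, γ ε tf = c tf

namespace System

variable {n : ℕ} {nl : Fin n → ℕ} (S : System n nl)

/-! ### The Lagrangian and the Lagrange–d'Alembert principle -/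

/-- Position of the `i`-th quadrotor. -/
noncomputable def quadPos (X : Config n nl) (i : Fin n) : V3 :=
  X.x0 + (X.R0 : Mat3) *ᵥ S.ρ i - ∑ a, S.l i a • (X.q i a : V3)

/-- Position of the `j`-th link of the `i`-th cable. -/
noncomputable def linkPos (X : Config n nl) (i : Fin n) (j : Fin (nl i)) : V3 :=
  X.x0 + (X.R0 : Mat3) *ᵥ S.ρ i - ∑ a ∈ Finset.Ioi j, S.l i a • (X.q i a : V3)

/-- Kinetic energy at time `t` of a motion `c`. -/
noncomputable def kinetic (c : ℝ → Config n nl) (t : ℝ) : ℝ :=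
  let v0 := deriv (fun s => (c s).x0) t
  let v := fun i => deriv (fun s => S.quadPos (c s) i) t
  let vL := fun i j => deriv (fun s => S.linkPos (c s) i j) t
  let Ω0 := bodyVel (fun s => (c s).R0) t
  let Ω := fun i => bodyVel (fun s => (c s).R i) t
  1 / 2 * S.m0 * (v0 ⬝ᵥ v0) + ∑ i, ∑ j, 1 / 2 * S.mL i j * (vL i j ⬝ᵥ vL i j)
    + 1 / 2 * ∑ i, S.m i * (v i ⬝ᵥ v i)
    + 1 / 2 * ∑ i, Ω i ⬝ᵥ (S.J i *ᵥ Ω i) + 1 / 2 * (Ω0 ⬝ᵥ (S.J0 *ᵥ Ω0))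

/-- Gravitational potential energy. -/
noncomputable def potential (X : Config n nl) : ℝ :=
  -(S.m0 * S.g * (e3 ⬝ᵥ X.x0)) - ∑ i, S.m i * S.g * (e3 ⬝ᵥ S.quadPos X i)
    - ∑ i, ∑ j, S.mL i j * S.g * (e3 ⬝ᵥ S.linkPos X i j)

/-- The Lagrangian `L = T - V` at time `t` along a motion `c`. -/
noncomputable def lagrangian (c : ℝ → Config n nl) (t : ℝ) : ℝ :=
  S.kinetic c t - S.potential (c t)

/-- The action integral of a motion `c` over `[t0, tf]`. -/
noncomputable def action (t0 tf : ℝ) (c : ℝ → Config n nl) : ℝ :=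
  ∫ t in t0..tf, S.lagrangian c t

/-- The virtual work of the thrusts `-fᵢ Rᵢ e₃` (acting at the quadrotors, in the inertial frame)
and of the moments `Mᵢ` (in the body-fixed frames) over the variation `γ`: the infinitesimal
variation of the position of a quadrotor is `∂x_i/∂ε`, and that of its attitude is the `η_i` with
`∂R_i/∂ε = R_i η̂_i`, both at `ε = 0`. -/
noncomputable def virtualWork (f : Fin n → ℝ → ℝ) (M : Fin n → ℝ → V3) (t0 tf : ℝ)
    (γ : ℝ → ℝ → Config n nl) : ℝ :=
  ∫ t in t0..tf, ∑ i,
    ((-(f i t • (((γ 0 t).R i : Mat3) *ᵥ e3))) ⬝ᵥ deriv (fun ε => S.quadPos (γ ε t) i) 0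
      + M i t ⬝ᵥ bodyVel (fun ε => (γ ε t).R i) 0)

/-- The Lagrange–d'Alembert (Hamilton) principle for the motion `c` over `[t0, tf]`: for every
variation with fixed end points, the variation of the action exists and is the negative of the
virtual work. -/
def LagrangeDAlembert (f : Fin n → ℝ → ℝ) (M : Fin n → ℝ → V3) (t0 tf : ℝ)
    (c : ℝ → Config n nl) : Prop :=
  ∀ γ : ℝ → ℝ → Config n nl, IsVariation t0 tf c γ →
    HasDerivAt (fun ε => S.action t0 tf (γ ε)) (-(S.virtualWork f M t0 tf γ)) 0

/-! ### The constants of the equations of motion -/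

/-- `M_iT`, the mass of the `i`-th quadrotor and its cable. -/
noncomputable def MiT (i : Fin n) : ℝ := ∑ j, S.mL i j + S.m i

/-- `M_T`, the total mass. -/
noncomputable def MT : ℝ := S.m0 + ∑ i, S.MiT i

/-- `M_0ij`, the mass of the `i`-th quadrotor and of the first `j - 1` links of its cable. -/
noncomputable def M0 (i : Fin n) (j : Fin (nl i)) : ℝ := S.m i + ∑ a ∈ Finset.Iio j, S.mL i a

/-- `J̄₀`. -/
noncomputable def Jbar0 : Mat3 := S.J0 - ∑ i, S.MiT i • hat (S.ρ i) ^ 2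

/-! ### The equations of motion -/

/-- Translation of the payload. -/
def PayloadTranslationEq (f : Fin n → ℝ → ℝ) (c : ℝ → Config n nl) (t : ℝ) : Prop :=
  let R0 : Mat3 := (c t).R0
  let Ω0 := bodyVel (fun s => (c s).R0)
  let ddx0 := deriv (deriv fun s => (c s).x0) t
  let ddq := fun i j => deriv (deriv fun s => ((c s).q i j : V3)) t
  S.MT • ddx0 - ∑ i, ∑ j, (S.M0 i j * S.l i j) • ddq i j
      - ∑ i, S.MiT i • ((R0 * hat (S.ρ i)) *ᵥ deriv Ω0 t)
    = (S.MT * S.g) • e3 + ∑ i, -(f i t • (((c t).R i : Mat3) *ᵥ e3))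
      - ∑ i, S.MiT i • ((R0 * hat (Ω0 t) ^ 2) *ᵥ S.ρ i)

/-- Rotation of the payload. -/
def PayloadRotationEq (f : Fin n → ℝ → ℝ) (c : ℝ → Config n nl) (t : ℝ) : Prop :=
  let R0 : Mat3 := (c t).R0
  let Ω0 := bodyVel (fun s => (c s).R0)
  let ddx0 := deriv (deriv fun s => (c s).x0) t
  let ddq := fun i j => deriv (deriv fun s => ((c s).q i j : V3)) t
  S.Jbar0 *ᵥ deriv Ω0 t + ∑ i, S.MiT i • ((hat (S.ρ i) * R0ᵀ) *ᵥ ddx0)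
      - ∑ i, ∑ j, (S.M0 i j * S.l i j) • ((hat (S.ρ i) * R0ᵀ) *ᵥ ddq i j)
    = ∑ i, (hat (S.ρ i) * R0ᵀ) *ᵥ
        (-(f i t • (((c t).R i : Mat3) *ᵥ e3)) + (S.MiT i * S.g) • e3)
      - hat (Ω0 t) *ᵥ (S.Jbar0 *ᵥ Ω0 t)

/-- Direction of the `j`-th link of the `i`-th cable. The second derivatives of the directions of
the links `j` and `k` of a cable are coupled through the mass above both links, `M_0ia` with
`a = min j k`. -/
def LinkEq (f : Fin n → ℝ → ℝ) (c : ℝ → Config n nl) (t : ℝ) (i : Fin n) (j : Fin (nl i)) :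
    Prop :=
  let R0 : Mat3 := (c t).R0
  let Ω0 := bodyVel (fun s => (c s).R0)
  let ddx0 := deriv (deriv fun s => (c s).x0) t
  let ddq := fun k => deriv (deriv fun s => ((c s).q i k : V3)) t
  let Q : Mat3 := hat ((c t).q i j) ^ 2
  ∑ k, (S.M0 i (min j k) * S.l i k) • (Q *ᵥ ddq k) - S.M0 i j • (Q *ᵥ ddx0)
      + S.M0 i j • ((Q * R0 * hat (S.ρ i)) *ᵥ deriv Ω0 t)
    = S.M0 i j • ((Q * R0 * hat (Ω0 t) ^ 2) *ᵥ S.ρ i)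
      - Q *ᵥ ((S.M0 i j * S.g) • e3 - f i t • (((c t).R i : Mat3) *ᵥ e3))

/-- Attitude of the `i`-th quadrotor. -/
def QuadAttitudeEq (M : Fin n → ℝ → V3) (c : ℝ → Config n nl) (t : ℝ) (i : Fin n) : Prop :=
  let Ω := bodyVel (fun s => (c s).R i)
  S.J i *ᵥ deriv Ω t + Ω t ⨯₃ (S.J i *ᵥ Ω t) = M i t

/-! ### The matrix form -/

/-- Index set of the coordinates of `X = [x₀, Ω₀, q₁ⱼ, …, qₙⱼ]`. -/
abbrev Idx (nl : Fin n → ℕ) : Type := Fin 3 ⊕ Fin 3 ⊕ ((i : Fin n) × (Fin (nl i) × Fin 3))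

/-- `N_{x₀Ω₀}`. -/
noncomputable def NxΩ (X : Config n nl) : Mat3 :=
  -∑ i, S.MiT i • ((X.R0 : Mat3) * hat (S.ρ i))

/-- `N_{Ω₀x₀}`. -/
noncomputable def NΩx (X : Config n nl) : Mat3 := (S.NxΩ X)ᵀ

/-- `N_{x₀i}`, a row of `nᵢ` blocks `-M_0ij l_ij I`. -/
noncomputable def Nxq (i : Fin n) : Matrix (Fin 3) (Fin (nl i) × Fin 3) ℝ :=
  Matrix.of fun a p => (-((S.M0 i p.1 * S.l i p.1) • (1 : Mat3))) a p.2

/-- `N_{Ω₀i}`, a row of `nᵢ` blocks `-M_0ij l_ij ρ̂_i R₀ᵀ`. -/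
noncomputable def NΩq (X : Config n nl) (i : Fin n) : Matrix (Fin 3) (Fin (nl i) × Fin 3) ℝ :=
  Matrix.of fun a p =>
    (-((S.M0 i p.1 * S.l i p.1) • (hat (S.ρ i) * (X.R0 : Mat3)ᵀ))) a p.2

/-- `N_{ix₀}`, a column of `nᵢ` blocks `-M_0ij q̂_ij²`. -/
noncomputable def Nqx (X : Config n nl) (i : Fin n) : Matrix (Fin (nl i) × Fin 3) (Fin 3) ℝ :=
  Matrix.of fun p b => (-(S.M0 i p.1 • hat (X.q i p.1) ^ 2)) p.2 b

/-- `N_{iΩ₀}`, a column of `nᵢ` blocks `M_0ij q̂_ij² R₀ ρ̂_i`. -/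
noncomputable def NqΩ (X : Config n nl) (i : Fin n) : Matrix (Fin (nl i) × Fin 3) (Fin 3) ℝ :=
  Matrix.of fun p b =>
    (S.M0 i p.1 • (hat (X.q i p.1) ^ 2 * (X.R0 : Mat3) * hat (S.ρ i))) p.2 b

/-- `N_{qqi}`, with the diagonal blocks `-M_0ij l_ij I` and, in block row `j` and block column
`k ≠ j`, the block `M_0ia l_ik q̂_ij²` with `a = min j k`. -/
noncomputable def Nqq (X : Config n nl) (i : Fin n) :
    Matrix (Fin (nl i) × Fin 3) (Fin (nl i) × Fin 3) ℝ :=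
  Matrix.of fun p r =>
    (if p.1 = r.1 then -((S.M0 i p.1 * S.l i p.1) • (1 : Mat3))
      else (S.M0 i (min p.1 r.1) * S.l i r.1) • hat (X.q i p.1) ^ 2) p.2 r.2

/-- The matrix `N`. -/
noncomputable def N (X : Config n nl) : Matrix (Idx nl) (Idx nl) ℝ :=
  Matrix.fromRows
    (Matrix.fromCols (S.MT • (1 : Mat3))
      (Matrix.fromCols (S.NxΩ X) (Matrix.of fun a p => S.Nxq p.1 a p.2)))
    (Matrix.fromRows
      (Matrix.fromCols (S.NΩx X)
        (Matrix.fromCols S.Jbar0 (Matrix.of fun a p => S.NΩq X p.1 a p.2)))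
      (Matrix.fromCols (Matrix.of fun p b => S.Nqx X p.1 p.2 b)
        (Matrix.fromCols (Matrix.of fun p b => S.NqΩ X p.1 p.2 b)
          (Matrix.blockDiagonal' (S.Nqq X)))))

/-- `P_{x₀}`, at the configuration `X`, the angular velocity `Ω0` of the payload and the thrust
magnitudes `f`. -/
noncomputable def Px (X : Config n nl) (Ω0 : V3) (f : Fin n → ℝ) : V3 :=
  (S.MT * S.g) • e3 + ∑ i, -(f i • ((X.R i : Mat3) *ᵥ e3))
    - ∑ i, S.MiT i • (((X.R0 : Mat3) * hat Ω0 ^ 2) *ᵥ S.ρ i)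

/-- `P_{Ω₀}`. -/
noncomputable def PΩ (X : Config n nl) (Ω0 : V3) (f : Fin n → ℝ) : V3 :=
  -(hat Ω0 *ᵥ (S.Jbar0 *ᵥ Ω0))
    + ∑ i, (hat (S.ρ i) * (X.R0 : Mat3)ᵀ) *ᵥ
        ((S.MiT i * S.g) • e3 - f i • ((X.R i : Mat3) *ᵥ e3))

/-- `P_ij`, where `dq` is the velocity of the link direction `q_ij`. -/
noncomputable def Pq (X : Config n nl) (Ω0 : V3) (f : Fin n → ℝ) (i : Fin n) (j : Fin (nl i))
    (dq : V3) : V3 :=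
  -(hat (X.q i j) ^ 2 *ᵥ (-(f i • ((X.R i : Mat3) *ᵥ e3)) + (S.M0 i j * S.g) • e3))
    + S.M0 i j • ((hat (X.q i j) ^ 2 * (X.R0 : Mat3) * hat Ω0 ^ 2) *ᵥ S.ρ i)
    + (S.M0 i j * S.l i j * (dq ⬝ᵥ dq)) • (X.q i j : V3)

/-- The vector `P`, where `dq` are the velocities of the link directions. -/
noncomputable def P (X : Config n nl) (Ω0 : V3) (dq : (i : Fin n) → Fin (nl i) → V3)
    (f : Fin n → ℝ) : Idx nl → ℝ :=
  Sum.elim (S.Px X Ω0 f) (Sum.elim (S.PΩ X Ω0 f)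
    fun p => S.Pq X Ω0 f p.1 p.2.1 (dq p.1 p.2.1) p.2.2)

end System

/-- The vector `[ẍ₀, Ω̇₀, q̈₁ⱼ, …, q̈ₙⱼ]` of a motion `c` at time `t`. -/
noncomputable def accel {n : ℕ} {nl : Fin n → ℕ} (c : ℝ → Config n nl) (t : ℝ) :
    System.Idx nl → ℝ :=
  Sum.elim (deriv (deriv fun s => (c s).x0) t)
    (Sum.elim (deriv (bodyVel fun s => (c s).R0) t)
      fun p => deriv (deriv fun s => ((c s).q p.1 p.2.1 : V3)) t p.2.2)

end CableTransport

/-! Along every admissible variation the action is differentiable, and integration by parts turns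
its derivative into minus an integral that pairs mass times (acceleration less gravity), and the
Euler terms of the rigid bodies, with the variations of the bodies (`hasFirstVariation_lagrangian`).
The rotational part rests on δΩ = η̇ + Ω × η (`deriv_bodyVel_variation`).

Each body of a cable sits at x₀ + R₀ρᵢ minus a partial sum of link vectors, so its variation is a
combination of δx₀, η₀ and the δq. Interchanging the sums along the cable (`cable_sum`) collects the
masses into M_iT, M_0ij and M_0i(j∧k). Once the virtual work is split off
(`eulerLagrangePairing_eq`), the principle says that the integral of `residualPairing` vanishes for
every variation. The link terms pair a load with δq, which is orthogonal to q; hence only the part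
of the load tangent to the sphere must vanish, and this is what q̂² detects.

If the equations hold, the pairing vanishes pointwise. Conversely, `axisVariation` supplies enough
variations: all its amplitudes are multiples of one scalar function φ, so the scalar fundamental
lemma applies and isolates each residual in turn.

The matrix form differs from the equations only in the diagonal blocks of N_qqi. Differentiating
|q|² = 1 twice gives q̂²q̈ = -|q̇|²q - q̈ (`hat_sq_mulVec_deriv_deriv`), which replaces q̂² by -I
there and puts the |q̇|² term into P. -/

namespace CableTransport

open MeasureTheory Filter Topology

/-! ### Calculus of two-parameter families -/

section TwoParameter

variable {E : Type*} [NormedAddCommGroup E] [NormedSpace ℝ E] {u : ℝ → ℝ → E} {k : WithTop ℕ∞}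

theorem hasDerivAt_left_of_contDiff (hu : ContDiff ℝ k fun p : ℝ × ℝ => u p.1 p.2) (hk : k ≠ 0)
    (ε t : ℝ) :
    HasDerivAt (fun e => u e t) (fderiv ℝ (fun p : ℝ × ℝ => u p.1 p.2) (ε, t) (1, 0)) ε := by
  have h1 : HasFDerivAt (fun p : ℝ × ℝ => u p.1 p.2) _ (ε, t) :=
    (hu.differentiable hk (ε, t)).hasFDerivAt
  have h2 : HasDerivAt (fun e : ℝ => (e, t)) ((1 : ℝ), (0 : ℝ)) ε :=
    (hasDerivAt_id ε).prodMk (hasDerivAt_const ε t)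
  exact h1.comp_hasDerivAt ε h2

theorem hasDerivAt_right_of_contDiff (hu : ContDiff ℝ k fun p : ℝ × ℝ => u p.1 p.2) (hk : k ≠ 0)
    (ε t : ℝ) :
    HasDerivAt (u ε) (fderiv ℝ (fun p : ℝ × ℝ => u p.1 p.2) (ε, t) (0, 1)) t := by
  have h1 : HasFDerivAt (fun p : ℝ × ℝ => u p.1 p.2) _ (ε, t) :=
    (hu.differentiable hk (ε, t)).hasFDerivAt
  have h2 : HasDerivAt (fun s : ℝ => (ε, s)) ((0 : ℝ), (1 : ℝ)) t :=
    (hasDerivAt_const t ε).prodMk (hasDerivAt_id t)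
  exact h1.comp_hasDerivAt t h2

theorem contDiff_deriv_left (hu : ContDiff ℝ 2 fun p : ℝ × ℝ => u p.1 p.2) :
    ContDiff ℝ 1 fun p : ℝ × ℝ => deriv (fun e => u e p.2) p.1 := by
  have h : (fun p : ℝ × ℝ => deriv (fun e => u e p.2) p.1) =
      fun p => fderiv ℝ (fun p : ℝ × ℝ => u p.1 p.2) p (1, 0) :=
    funext fun p => (hasDerivAt_left_of_contDiff hu two_ne_zero p.1 p.2).deriv
  rw [h]
  exact (hu.fderiv_right (m := 1) (by norm_num)).clm_apply contDiff_const

theorem contDiff_deriv_right (hu : ContDiff ℝ 2 fun p : ℝ × ℝ => u p.1 p.2) :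
    ContDiff ℝ 1 fun p : ℝ × ℝ => deriv (u p.1) p.2 := by
  have h : (fun p : ℝ × ℝ => deriv (u p.1) p.2) =
      fun p => fderiv ℝ (fun p : ℝ × ℝ => u p.1 p.2) p (0, 1) :=
    funext fun p => (hasDerivAt_right_of_contDiff hu two_ne_zero p.1 p.2).deriv
  rw [h]
  exact (hu.fderiv_right (m := 1) (by norm_num)).clm_apply contDiff_const

theorem continuous_deriv_left (hu : ContDiff ℝ 1 fun p : ℝ × ℝ => u p.1 p.2) :
    Continuous fun p : ℝ × ℝ => deriv (fun e => u e p.2) p.1 := by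
  have h : (fun p : ℝ × ℝ => deriv (fun e => u e p.2) p.1) =
      fun p => fderiv ℝ (fun p : ℝ × ℝ => u p.1 p.2) p (1, 0) :=
    funext fun p => (hasDerivAt_left_of_contDiff hu one_ne_zero p.1 p.2).deriv
  rw [h]
  exact (hu.continuous_fderiv one_ne_zero).clm_apply continuous_const

/-- Mixed partial derivatives of a `C²` function commute. -/
theorem deriv_deriv_comm (hu : ContDiff ℝ 2 fun p : ℝ × ℝ => u p.1 p.2) (ε t : ℝ) :
    deriv (fun e => deriv (u e) t) ε = deriv (fun s => deriv (fun e => u e s) ε) t := by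
  let F : ℝ × ℝ → E := fun p => u p.1 p.2
  have hF1 : ContDiff ℝ 1 (fderiv ℝ F) := hu.fderiv_right (by norm_num)
  have hF2 : ∀ v : ℝ × ℝ, ContDiff ℝ 1 fun p : ℝ × ℝ => fderiv ℝ F (p.1, p.2) v :=
    fun v => hF1.clm_apply contDiff_const
  have hd : DifferentiableAt ℝ (fderiv ℝ F) (ε, t) := hF1.differentiable one_ne_zero _
  have hd' : ∀ v w : ℝ × ℝ, fderiv ℝ (fun p => fderiv ℝ F p v) (ε, t) w =
      fderiv ℝ (fderiv ℝ F) (ε, t) w v := fun v w => by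
    rw [fderiv_clm_apply hd (differentiableAt_const v)]
    simp
  have h1 : (fun e => deriv (u e) t) = fun e => fderiv ℝ F (e, t) (0, 1) :=
    funext fun e => (hasDerivAt_right_of_contDiff hu two_ne_zero e t).deriv
  have h2 : (fun s => deriv (fun e => u e s) ε) = fun s => fderiv ℝ F (ε, s) (1, 0) :=
    funext fun s => (hasDerivAt_left_of_contDiff hu two_ne_zero ε s).deriv
  have hs : IsSymmSndFDerivAt ℝ F (ε, t) :=
    ContDiffAt.isSymmSndFDerivAt (n := 2) hu.contDiffAt (by simp)
  rw [h1, h2,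
    (hasDerivAt_left_of_contDiff (u := fun e s => fderiv ℝ F (e, s) (0, 1))
      (hF2 _) one_ne_zero ε t).deriv,
    (hasDerivAt_right_of_contDiff (u := fun e s => fderiv ℝ F (e, s) (1, 0))
      (hF2 _) one_ne_zero ε t).deriv]
  exact (hd' _ _).trans ((hs.eq _ _).trans (hd' _ _).symm)

theorem contDiff_slice_left {k : WithTop ℕ∞} (hu : ContDiff ℝ k fun p : ℝ × ℝ => u p.1 p.2)
    (ε : ℝ) : ContDiff ℝ k (u ε) :=
  hu.comp (contDiff_const.prodMk contDiff_id : ContDiff ℝ k fun t : ℝ => (ε, t))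

theorem contDiff_slice_right {k : WithTop ℕ∞} (hu : ContDiff ℝ k fun p : ℝ × ℝ => u p.1 p.2)
    (t : ℝ) : ContDiff ℝ k fun ε => u ε t :=
  hu.comp (contDiff_id.prodMk contDiff_const : ContDiff ℝ k fun ε : ℝ => (ε, t))

end TwoParameter

/-- The ε-derivative is jointly continuous, hence bounded by a constant on the compact product of a
ball around ε₀ and the interval; this constant is the dominating function. -/
theorem hasDerivAt_intervalIntegral_of_contDiff {L : ℝ → ℝ → ℝ}
    (hL : ContDiff ℝ 1 fun p : ℝ × ℝ => L p.1 p.2) (a b ε₀ : ℝ) :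
    HasDerivAt (fun ε => ∫ t in a..b, L ε t) (∫ t in a..b, deriv (fun ε => L ε t) ε₀) ε₀ := by
  have hc := continuous_deriv_left hL
  have hK : IsCompact (Metric.closedBall ε₀ 1 ×ˢ Set.uIcc a b) :=
    (isCompact_closedBall _ _).prod isCompact_uIcc
  obtain ⟨C, hC⟩ := hK.exists_bound_of_continuousOn hc.continuousOn
  refine (intervalIntegral.hasDerivAt_integral_of_dominated_loc_of_deriv_le
    (F' := fun ε t => deriv (fun ε => L ε t) ε) (bound := fun _ => C)
    (Metric.closedBall_mem_nhds ε₀ one_pos) ?_ ?_ ?_ ?_ ?_ ?_).2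
  · exact Eventually.of_forall fun ε =>
      (contDiff_slice_left hL ε).continuous.aestronglyMeasurable
  · exact (contDiff_slice_left hL ε₀).continuous.intervalIntegrable _ _
  · exact (hc.comp (by fun_prop : Continuous fun t : ℝ => (ε₀, t))).aestronglyMeasurable
  · exact Eventually.of_forall fun t ht ε hε => hC (ε, t) ⟨hε, Set.uIoc_subset_uIcc ht⟩
  · exact intervalIntegrable_const
  · exact Eventually.of_forall fun t _ ε _ =>
      ((contDiff_slice_right hL t).differentiable one_ne_zero ε).hasDerivAt

/-! ### First variations of integral functionals -/

/-- The integral over `[a, b]` of the functional `L ε` has the first variation `-∫ G` at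
`ε = 0`. -/
structure HasFirstVariation (a b : ℝ) (L : ℝ → ℝ → ℝ) (G : ℝ → ℝ) : Prop where
  continuous_left : ∀ ε, Continuous (L ε)
  continuous_right : Continuous G
  hasDerivAt : HasDerivAt (fun ε => ∫ t in a..b, L ε t) (-∫ t in a..b, G t) 0

namespace HasFirstVariation

variable {a b : ℝ} {L L' : ℝ → ℝ → ℝ} {G G' : ℝ → ℝ}

/-- The continuity fields of the structure make all integrals split, so the first variation of the
Lagrangian can be assembled term by term. -/
theorem add (h : HasFirstVariation a b L G) (h' : HasFirstVariation a b L' G') :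
    HasFirstVariation a b (fun ε t => L ε t + L' ε t) (fun t => G t + G' t) where
  continuous_left ε := (h.continuous_left ε).add (h'.continuous_left ε)
  continuous_right := h.continuous_right.add h'.continuous_right
  hasDerivAt := by
    have e : (fun ε => ∫ t in a..b, L ε t + L' ε t) =
        fun ε => (∫ t in a..b, L ε t) + ∫ t in a..b, L' ε t := funext fun ε =>
      intervalIntegral.integral_add ((h.continuous_left ε).intervalIntegrable _ _)
        ((h'.continuous_left ε).intervalIntegrable _ _)
    rw [e, intervalIntegral.integral_add (h.continuous_right.intervalIntegrable _ _)
        (h'.continuous_right.intervalIntegrable _ _), neg_add]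
    exact h.hasDerivAt.add h'.hasDerivAt

theorem const_mul (r : ℝ) (h : HasFirstVariation a b L G) :
    HasFirstVariation a b (fun ε t => r * L ε t) (fun t => r * G t) where
  continuous_left ε := (h.continuous_left ε).const_mul r
  continuous_right := h.continuous_right.const_mul r
  hasDerivAt := by
    simp only [intervalIntegral.integral_const_mul]
    rw [← mul_neg]
    exact h.hasDerivAt.const_mul r

theorem sub (h : HasFirstVariation a b L G) (h' : HasFirstVariation a b L' G') :
    HasFirstVariation a b (fun ε t => L ε t - L' ε t) (fun t => G t - G' t) := by
  simpa [sub_eq_add_neg] using h.add (h'.const_mul (-1))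

theorem zero : HasFirstVariation a b (fun _ _ => 0) (fun _ => 0) where
  continuous_left _ := continuous_const
  continuous_right := continuous_const
  hasDerivAt := by simpa using hasDerivAt_const (0 : ℝ) (0 : ℝ)

theorem sum {ι : Type*} (s : Finset ι) {L : ι → ℝ → ℝ → ℝ} {G : ι → ℝ → ℝ}
    (h : ∀ i ∈ s, HasFirstVariation a b (L i) (G i)) :
    HasFirstVariation a b (fun ε t => ∑ i ∈ s, L i ε t) (fun t => ∑ i ∈ s, G i t) := by
  classical
  induction s using Finset.induction_on with
  | empty => simpa using zero
  | insert i s hi ih =>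
    simp only [Finset.sum_insert hi]
    exact (h i (Finset.mem_insert_self i s)).add
      (ih fun j hj => h j (Finset.mem_insert_of_mem hj))

/-- Integration by parts: the derivative of `L` in `ε` may be changed by the derivative of a
function that vanishes at the end points. -/
theorem of_deriv (hL : ContDiff ℝ 1 fun p : ℝ × ℝ => L p.1 p.2) {B : ℝ → ℝ}
    (hB : ContDiff ℝ 1 B) (ha : B a = 0) (hb : B b = 0)
    (h : ∀ t, deriv (fun ε => L ε t) 0 = deriv B t - G t) : HasFirstVariation a b L G := by
  have hB' : Continuous (deriv B) := hB.continuous_deriv le_rfl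
  have hL' : Continuous fun t => deriv (fun ε => L ε t) 0 :=
    (continuous_deriv_left hL).comp (by fun_prop : Continuous fun t : ℝ => ((0 : ℝ), t))
  have hG : Continuous G := by
    have : G = fun t => deriv B t - deriv (fun ε => L ε t) 0 := by
      funext t; rw [h]; ring
    rw [this]
    exact hB'.sub hL'
  refine ⟨fun ε => (contDiff_slice_left hL ε).continuous, hG, ?_⟩
  have hd := hasDerivAt_intervalIntegral_of_contDiff hL a b 0
  simp only [h] at hd
  rw [intervalIntegral.integral_sub (hB'.intervalIntegrable _ _) (hG.intervalIntegrable _ _),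
    intervalIntegral.integral_deriv_eq_sub
      (fun t _ => hB.differentiable one_ne_zero t) (hB'.intervalIntegrable _ _),
    ha, hb, sub_zero, zero_sub] at hd
  exact hd

end HasFirstVariation

theorem deriv_left_eq_zero {E : Type*} [NormedAddCommGroup E] [NormedSpace ℝ E] {u : ℝ → ℝ → E}
    {t : ℝ} (h : ∀ ε, u ε t = u 0 t) :
    deriv (fun e => u e t) 0 = 0 := by
  rw [funext h]; simp

theorem hasFirstVariation_self {y : ℝ → ℝ → ℝ} (hy : ContDiff ℝ 2 fun p : ℝ × ℝ => y p.1 p.2)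
    (a b : ℝ) :
    HasFirstVariation a b y (fun t => -deriv (fun ε => y ε t) 0) :=
  .of_deriv (B := fun _ => 0) (hy.of_le (by norm_num)) contDiff_const rfl rfl (by simp)

/-- Since mixed partials commute, δ(ẏ²) = 2ẏ(δy)˙ = (2ẏδy)˙ - 2ÿδy, and the boundary function 2ẏδy
vanishes at the fixed end points. -/
theorem hasFirstVariation_deriv_sq {y : ℝ → ℝ → ℝ}
    (hy : ContDiff ℝ 2 fun p : ℝ × ℝ => y p.1 p.2) {a b : ℝ} (ha : ∀ ε, y ε a = y 0 a)
    (hb : ∀ ε, y ε b = y 0 b) :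
    HasFirstVariation a b (fun ε t => deriv (y ε) t * deriv (y ε) t)
      (fun t => 2 * (deriv (deriv (y 0)) t * deriv (fun ε => y ε t) 0)) := by
  have h1 := contDiff_deriv_right hy
  have h2 := contDiff_deriv_left hy
  have h3 : ContDiff ℝ 1 (deriv (y 0)) := contDiff_slice_left (u := fun ε t => deriv (y ε) t) h1 0
  have h4 : ContDiff ℝ 1 fun t => deriv (fun ε => y ε t) 0 :=
    contDiff_slice_left (u := fun ε t => deriv (fun e => y e t) ε) h2 0
  refine .of_deriv (B := fun t => 2 * (deriv (y 0) t * deriv (fun ε => y ε t) 0))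
    (h1.mul h1) (by fun_prop) (by simp [deriv_left_eq_zero ha])
    (by simp [deriv_left_eq_zero hb]) fun t => ?_
  have h5 : DifferentiableAt ℝ (fun ε => deriv (y ε) t) 0 :=
    (contDiff_slice_right (u := fun ε t => deriv (y ε) t) h1 t).differentiable one_ne_zero 0
  have h6 := h3.differentiable one_ne_zero t
  have h7 := h4.differentiable one_ne_zero t
  rw [deriv_fun_mul h5 h5, deriv_const_mul _ (h6.fun_mul h7), deriv_fun_mul h6 h7,
    deriv_deriv_comm hy]
  ring

/-- The fundamental lemma of the calculus of variations on a compact interval. -/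
theorem eq_zero_of_forall_integral_mul_eq_zero {a b : ℝ} (hab : a < b) {g : ℝ → ℝ}
    (hg : ContinuousOn g (Set.Icc a b))
    (h : ∀ φ : ℝ → ℝ, ContDiff ℝ 2 φ → φ a = 0 → φ b = 0 → ∫ t in a..b, φ t * g t = 0) :
    ∀ t ∈ Set.Icc a b, g t = 0 := by
  have key : ∀ᵐ x ∂(volume : Measure ℝ), x ∈ Set.Ioo a b → g x = 0 := by
    refine isOpen_Ioo.ae_eq_zero_of_integral_contDiff_smul_eq_zero
      ((hg.mono Set.Ioo_subset_Icc_self).locallyIntegrableOn measurableSet_Ioo) ?_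
    intro φ hφ _ hs
    have hout : ∀ x ∉ Set.Ioo a b, φ x = 0 := fun x hx =>
      image_eq_zero_of_notMem_tsupport fun hx' => hx (hs hx')
    -- A smooth function supported in the open interval is an admissible test function: it vanishes
    -- at both end points.
    have h0 := h φ (contDiff_infty.1 hφ 2) (hout a (by simp)) (hout b (by simp))
    rw [intervalIntegral.integral_of_le hab.le] at h0
    rw [← h0, setIntegral_eq_integral_of_forall_compl_eq_zero]
    · rfl
    · intro x hx
      rw [hout x fun hx' => hx (Set.Ioo_subset_Ioc_self hx'), zero_mul]
  -- Passing from the open to the closed interval costs only a null set; continuity then upgrades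
  -- almost everywhere to everywhere, end points included.
  have hae : g =ᵐ[volume.restrict (Set.Icc a b)] fun _ => 0 := by
    rw [← Measure.restrict_congr_set Ioo_ae_eq_Icc, EventuallyEq,
      ae_restrict_iff' measurableSet_Ioo]
    exact key
  exact fun t ht => Measure.eqOn_Icc_of_ae_eq volume hab.ne hae hg continuousOn_const ht

/-! ### Calculus of vector-valued and matrix-valued curves -/

section VectorCalculus

variable {E : Type*} [NormedAddCommGroup E] [NormedSpace ℝ E]

theorem deriv_apply_of_contDiff {y : ℝ → V3} (hy : ContDiff ℝ 1 y) (t : ℝ) (a : Fin 3) :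
    deriv y t a = deriv (fun s => y s a) t := by
  rw [deriv_pi fun a => ((contDiff_pi.1 hy a).differentiable one_ne_zero t)]

theorem contDiff_dotProduct {k : WithTop ℕ∞} {u v : E → V3} (hu : ContDiff ℝ k u)
    (hv : ContDiff ℝ k v) : ContDiff ℝ k fun p => u p ⬝ᵥ v p :=
  .sum fun a _ => (contDiff_pi.1 hu a).mul (contDiff_pi.1 hv a)

theorem contDiff_const_mulVec {k : WithTop ℕ∞} (A : Mat3) {u : E → V3} (hu : ContDiff ℝ k u) :
    ContDiff ℝ k fun p => A *ᵥ u p :=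
  contDiff_pi.2 fun _ => contDiff_dotProduct contDiff_const hu

theorem hasDerivAt_dotProduct {u v : ℝ → V3} {u' v' : V3} {t : ℝ} (hu : HasDerivAt u u' t)
    (hv : HasDerivAt v v' t) :
    HasDerivAt (fun s => u s ⬝ᵥ v s) (u' ⬝ᵥ v t + u t ⬝ᵥ v') t := by
  rw [dotProduct, dotProduct, ← Finset.sum_add_distrib]
  exact HasDerivAt.fun_sum fun a _ => (hasDerivAt_pi.1 hu a).mul (hasDerivAt_pi.1 hv a)

theorem hasDerivAt_const_mulVec (A : Mat3) {u : ℝ → V3} {u' : V3} {t : ℝ}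
    (hu : HasDerivAt u u' t) : HasDerivAt (fun s => A *ᵥ u s) (A *ᵥ u') t :=
  hasDerivAt_pi.2 fun a => by
    simpa [Matrix.mulVec] using hasDerivAt_dotProduct (hasDerivAt_const t (A a)) hu

theorem hasFirstVariation_dotProduct (w : V3) {y : ℝ → ℝ → V3}
    (hy : ContDiff ℝ 2 fun p : ℝ × ℝ => y p.1 p.2) (a b : ℝ) :
    HasFirstVariation a b (fun ε t => w ⬝ᵥ y ε t)
      (fun t => -(w ⬝ᵥ deriv (fun ε => y ε t) 0)) := by
  have h := hasFirstVariation_self (y := fun ε t => w ⬝ᵥ y ε t)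
    (contDiff_dotProduct contDiff_const hy) a b
  convert h using 3 with t
  have hd := ((contDiff_slice_right hy t).differentiable two_ne_zero 0).hasDerivAt
  simpa using (hasDerivAt_dotProduct (hasDerivAt_const 0 w) hd).deriv.symm

theorem hasFirstVariation_deriv_dotProduct_self {y : ℝ → ℝ → V3}
    (hy : ContDiff ℝ 2 fun p : ℝ × ℝ => y p.1 p.2) {a b : ℝ} (ha : ∀ ε, y ε a = y 0 a)
    (hb : ∀ ε, y ε b = y 0 b) :
    HasFirstVariation a b (fun ε t => deriv (y ε) t ⬝ᵥ deriv (y ε) t)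
      (fun t => 2 * (deriv (deriv (y 0)) t ⬝ᵥ deriv (fun ε => y ε t) 0)) := by
  have h := HasFirstVariation.sum Finset.univ fun k (_ : k ∈ Finset.univ) =>
    hasFirstVariation_deriv_sq (y := fun ε t => y ε t k) (contDiff_pi.1 hy k)
      (fun ε => congrFun (ha ε) k) (fun ε => congrFun (hb ε) k)
  have h1 : ∀ ε t k, deriv (y ε) t k = deriv (fun s => y ε s k) t := fun ε t k =>
    deriv_apply_of_contDiff ((contDiff_slice_left hy ε).of_le (by norm_num)) t k
  have h2 : ∀ t k, deriv (fun ε => y ε t) 0 k = deriv (fun ε => y ε t k) 0 := fun t k =>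
    deriv_apply_of_contDiff ((contDiff_slice_right hy t).of_le (by norm_num)) 0 k
  have h3 : ∀ t k, deriv (deriv (y 0)) t k = deriv (deriv fun s => y 0 s k) t := fun t k => by
    rw [deriv_apply_of_contDiff (contDiff_slice_left (u := fun ε t => deriv (y ε) t)
      (contDiff_deriv_right hy) 0)]
    simp only [h1]
  simpa only [dotProduct, h1, h2, h3, Finset.mul_sum] using h

end VectorCalculus

section MatrixCalculus

theorem matDeriv_mul {A B : ℝ → Mat3} {t : ℝ} (hA : ∀ a b, DifferentiableAt ℝ (fun s => A s a b) t)
    (hB : ∀ a b, DifferentiableAt ℝ (fun s => B s a b) t) :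
    matDeriv (fun s => A s * B s) t = matDeriv A t * B t + A t * matDeriv B t := by
  ext a b
  simp only [matDeriv, Matrix.mul_apply, Matrix.of_apply, Matrix.add_apply]
  rw [← Finset.sum_add_distrib]
  exact (HasDerivAt.fun_sum fun k _ => (hA a k).hasDerivAt.mul (hB k b).hasDerivAt).deriv

theorem differentiableAt_matrix_mul {A B : ℝ → Mat3} {t : ℝ}
    (hA : ∀ a b, DifferentiableAt ℝ (fun s => A s a b) t)
    (hB : ∀ a b, DifferentiableAt ℝ (fun s => B s a b) t) (a b : Fin 3) :
    DifferentiableAt ℝ (fun s => (A s * B s) a b) t := by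
  simp only [Matrix.mul_apply]
  exact DifferentiableAt.fun_sum fun k _ => (hA a k).mul (hB k b)

theorem matDeriv_transpose (A : ℝ → Mat3) (t : ℝ) :
    matDeriv (fun s => (A s)ᵀ) t = (matDeriv A t)ᵀ := rfl

theorem matDeriv_hat {u : ℝ → V3} {t : ℝ} (hu : DifferentiableAt ℝ u t) :
    matDeriv (fun s => hat (u s)) t = hat (deriv u t) := by
  rw [deriv_pi (differentiableAt_pi.1 hu)]
  ext a b
  fin_cases a <;> fin_cases b <;> simp [matDeriv, hat]

theorem deriv_vee {A : ℝ → Mat3} {t : ℝ} (hA : ∀ a b, DifferentiableAt ℝ (fun s => A s a b) t) :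
    deriv (fun s => vee (A s)) t = vee (matDeriv A t) := by
  rw [deriv_pi]
  · ext a
    fin_cases a <;> simp [vee, matDeriv]
  · intro a
    fin_cases a <;> simpa [vee] using hA _ _

theorem hasDerivAt_mulVec_const {A : ℝ → Mat3} {t : ℝ}
    (hA : ∀ a b, DifferentiableAt ℝ (fun s => A s a b) t) (v : V3) :
    HasDerivAt (fun s => A s *ᵥ v) (matDeriv A t *ᵥ v) t :=
  hasDerivAt_pi.2 fun a =>
    HasDerivAt.fun_sum (u := Finset.univ) fun b _ => (hA a b).hasDerivAt.mul_const (v b)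

theorem contDiff_mulVec_const {E : Type*} [NormedAddCommGroup E] [NormedSpace ℝ E]
    {k : WithTop ℕ∞} {A : E → Mat3} (hA : ∀ a b, ContDiff ℝ k fun p => A p a b) (v : V3) :
    ContDiff ℝ k fun p => A p *ᵥ v :=
  contDiff_pi.2 fun a => ContDiff.sum (s := Finset.univ) fun b _ =>
    (hA a b).mul (contDiff_const (c := v b))

end MatrixCalculus

/-! ### Rotations and their angular velocities -/

section Rotation

theorem SO3.transpose_mul_self (R : SO3) : (R : Mat3)ᵀ * (R : Mat3) = 1 := by
  have h := (Matrix.mem_specialOrthogonalGroup_iff.1 R.2).1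
  simpa [Matrix.star_eq_conjTranspose] using (Matrix.mem_orthogonalGroup_iff' (Fin 3) ℝ).1 h

theorem SO3.mul_transpose_self (R : SO3) : (R : Mat3) * (R : Mat3)ᵀ = 1 :=
  mul_eq_one_comm.1 R.transpose_mul_self

theorem hat_transpose (v : V3) : (hat v)ᵀ = -hat v := by
  ext a b
  fin_cases a <;> fin_cases b <;> simp [hat]

/-- Differentiating RᵀR = 1 shows that RᵀṘ is skew, so `hat` undoes the `vee` in the definition of
the body velocity. -/
theorem matDeriv_eq_mul_hat_bodyVel {R : ℝ → SO3} {t : ℝ}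
    (hR : ∀ a b, DifferentiableAt ℝ (fun s => (R s : Mat3) a b) t) :
    matDeriv (fun s => (R s : Mat3)) t = (R t : Mat3) * hat (bodyVel R t) := by
  have h := matDeriv_mul (A := fun s => (R s : Mat3)ᵀ) (fun a b => hR b a) hR
  simp only [SO3.transpose_mul_self] at h
  rw [matDeriv_transpose] at h
  have h0 : matDeriv (fun _ => (1 : Mat3)) t = 0 := by
    ext a b
    simp [matDeriv]
  rw [h0] at h
  rw [bodyVel, hat_vee, ← Matrix.mul_assoc, SO3.mul_transpose_self, Matrix.one_mul]
  rw [Matrix.transpose_mul, Matrix.transpose_transpose]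
  exact eq_neg_of_add_eq_zero_left h.symm

theorem contDiff_bodyVel_left {R : ℝ → ℝ → SO3}
    (hR : ∀ a b, ContDiff ℝ 2 fun p : ℝ × ℝ => (R p.1 p.2 : Mat3) a b) :
    ContDiff ℝ 1 fun p : ℝ × ℝ => bodyVel (fun e => R e p.2) p.1 := by
  refine contDiff_pi.2 fun k => ?_
  have h1 : ∀ a b, ContDiff ℝ 1 fun p : ℝ × ℝ => (R p.1 p.2 : Mat3) a b := fun a b =>
    (hR a b).of_le (by norm_num)
  have h2 : ∀ a b, ContDiff ℝ 1 fun p : ℝ × ℝ => deriv (fun e => (R e p.2 : Mat3) a b) p.1 :=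
    fun a b => contDiff_deriv_left (u := fun e s => (R e s : Mat3) a b) (hR a b)
  fin_cases k <;>
    simpa [bodyVel, vee, Matrix.mul_apply, matDeriv, Fin.sum_univ_three] using
      (((h1 _ _).mul (h2 _ _)).add ((h1 _ _).mul (h2 _ _))).add ((h1 _ _).mul (h2 _ _))

theorem contDiff_bodyVel_right {R : ℝ → ℝ → SO3}
    (hR : ∀ a b, ContDiff ℝ 2 fun p : ℝ × ℝ => (R p.1 p.2 : Mat3) a b) :
    ContDiff ℝ 1 fun p : ℝ × ℝ => bodyVel (R p.1) p.2 :=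
  (contDiff_bodyVel_left (R := fun t ε => R ε t)
    (fun a b => (hR a b).comp (contDiff_snd.prodMk contDiff_fst))).comp
    (contDiff_snd.prodMk contDiff_fst : ContDiff ℝ 1 fun p : ℝ × ℝ => (p.2, p.1))

/-- The variation of the body-fixed angular velocity: `δΩ = η̇ + Ω × η`. -/
theorem deriv_bodyVel_variation {R : ℝ → ℝ → SO3}
    (hR : ∀ a b, ContDiff ℝ 2 fun p : ℝ × ℝ => (R p.1 p.2 : Mat3) a b) (ε t : ℝ) :
    deriv (fun e => bodyVel (R e) t) ε =
      deriv (fun s => bodyVel (fun e => R e s) ε) t +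
        bodyVel (R ε) t ⨯₃ bodyVel (fun e => R e t) ε := by
  have hl : ∀ a b, DifferentiableAt ℝ (fun e => (R e t : Mat3) a b) ε := fun a b =>
    (contDiff_slice_right (u := fun e s => (R e s : Mat3) a b) (hR a b) t).differentiable
      two_ne_zero ε
  have hr : ∀ a b, DifferentiableAt ℝ (fun s => (R ε s : Mat3) a b) t := fun a b =>
    (contDiff_slice_left (u := fun e s => (R e s : Mat3) a b) (hR a b) ε).differentiable
      two_ne_zero t
  have hlr : ∀ a b, DifferentiableAt ℝ
      (fun e => matDeriv (fun s => (R e s : Mat3)) t a b) ε := fun a b =>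
    (contDiff_slice_right (u := fun e s => deriv (fun s => (R e s : Mat3) a b) s)
      (contDiff_deriv_right (u := fun e s => (R e s : Mat3) a b) (hR a b)) t).differentiable
      one_ne_zero ε
  have hrl : ∀ a b, DifferentiableAt ℝ
      (fun s => matDeriv (fun e => (R e s : Mat3)) ε a b) t := fun a b =>
    (contDiff_slice_left (u := fun e s => deriv (fun e => (R e s : Mat3) a b) e)
      (contDiff_deriv_left (u := fun e s => (R e s : Mat3) a b) (hR a b)) ε).differentiable
      one_ne_zero t
  have hcomm : matDeriv (fun e => matDeriv (fun s => (R e s : Mat3)) t) ε =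
      matDeriv (fun s => matDeriv (fun e => (R e s : Mat3)) ε) t := by
    ext a b
    exact deriv_deriv_comm (u := fun e s => (R e s : Mat3) a b) (hR a b) ε t
  have hlT : ∀ a b, DifferentiableAt ℝ (fun e => (R e t : Mat3)ᵀ a b) ε := fun a b => hl b a
  have hrT : ∀ a b, DifferentiableAt ℝ (fun s => (R ε s : Mat3)ᵀ a b) t := fun a b => hr b a
  have e1 : deriv (fun e => bodyVel (R e) t) ε = _ :=
    deriv_vee (differentiableAt_matrix_mul hlT hlr)
  have e2 : deriv (fun s => bodyVel (fun e => R e s) ε) t = _ :=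
    deriv_vee (differentiableAt_matrix_mul hrT hrl)
  -- Both sides contain the same mixed derivative Rᵀ∂ₜ∂_εR. What remains is -η̂Ω̂ on the left and
  -- -Ω̂η̂ on the right, and their difference is the commutator [Ω̂, η̂], the hat of Ω × η.
  rw [e1, e2, matDeriv_mul hlT hlr, matDeriv_mul hrT hrl, matDeriv_transpose, matDeriv_transpose, hcomm, matDeriv_eq_mul_hat_bodyVel hl,
    matDeriv_eq_mul_hat_bodyVel hr, Matrix.transpose_mul, Matrix.transpose_mul,
    Matrix.mul_assoc _ (R ε t : Mat3)ᵀ, Matrix.mul_assoc _ (R ε t : Mat3)ᵀ,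
    ← Matrix.mul_assoc (R ε t : Mat3)ᵀ, ← Matrix.mul_assoc (R ε t : Mat3)ᵀ,
    SO3.transpose_mul_self, Matrix.one_mul, Matrix.one_mul]
  generalize bodyVel (R ε) t = Ω
  generalize bodyVel (fun e => R e t) ε = η
  ext k
  fin_cases k <;>
    simp [vee, hat, cross_apply, Matrix.mul_apply, Fin.sum_univ_three] <;> ring

theorem bodyVel_const (R : SO3) (t : ℝ) : bodyVel (fun _ => R) t = 0 := by
  have : matDeriv (fun _ => (R : Mat3)) t = 0 := by
    ext a b
    simp [matDeriv]
  ext k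
  fin_cases k <;> simp [bodyVel, this, vee]

/-- The first variation of (twice) the rotational kinetic energy of a rigid body. -/
theorem hasFirstVariation_rotational {J : Mat3} (hJ : J.IsSymm) {R : ℝ → ℝ → SO3}
    (hR : ∀ a b, ContDiff ℝ 2 fun p : ℝ × ℝ => (R p.1 p.2 : Mat3) a b) {a b : ℝ}
    (ha : ∀ ε, R ε a = R 0 a) (hb : ∀ ε, R ε b = R 0 b) :
    HasFirstVariation a b (fun ε t => bodyVel (R ε) t ⬝ᵥ (J *ᵥ bodyVel (R ε) t))
      (fun t => 2 * ((J *ᵥ deriv (bodyVel (R 0)) t +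
        bodyVel (R 0) t ⨯₃ (J *ᵥ bodyVel (R 0) t)) ⬝ᵥ bodyVel (fun ε => R ε t) 0)) := by
  have hr := contDiff_bodyVel_right hR
  have hl := contDiff_bodyVel_left hR
  have hΩ : ContDiff ℝ 1 (bodyVel (R 0)) := contDiff_slice_left (u := fun e => bodyVel (R e)) hr 0
  have hη : ContDiff ℝ 1 fun t => bodyVel (fun ε => R ε t) 0 :=
    contDiff_slice_left (u := fun e t => bodyVel (fun ε => R ε t) e) hl 0
  have hz : ∀ t, (∀ ε, R ε t = R 0 t) → bodyVel (fun ε => R ε t) 0 = 0 := fun t h => by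
    rw [funext h]
    exact bodyVel_const _ _
  refine .of_deriv
    (B := fun t => 2 * ((J *ᵥ bodyVel (R 0) t) ⬝ᵥ bodyVel (fun ε => R ε t) 0))
    (contDiff_dotProduct hr (contDiff_const_mulVec J hr))
    (contDiff_const.mul (contDiff_dotProduct (contDiff_const_mulVec J hΩ) hη))
    (by simp [hz a ha]) (by simp [hz b hb]) fun t => ?_
  have d1 := ((contDiff_slice_right (u := fun e => bodyVel (R e)) hr t).differentiable
    one_ne_zero 0).hasDerivAt
  have d2 := (hΩ.differentiable one_ne_zero t).hasDerivAt
  have d3 := (hη.differentiable one_ne_zero t).hasDerivAt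
  rw [(hasDerivAt_dotProduct d1 (hasDerivAt_const_mulVec J d1)).deriv,
    ((hasDerivAt_dotProduct (hasDerivAt_const_mulVec J d2) d3).const_mul 2).deriv,
    deriv_bodyVel_variation hR]
  generalize deriv (fun s => bodyVel (fun e => R e s) 0) t = η'
  generalize bodyVel (fun e => R e t) 0 = η
  generalize deriv (bodyVel (R 0)) t = Ω'
  generalize bodyVel (R 0) t = Ω
  -- Symmetry of J merges the two terms of the product rule into 2 JΩ · δΩ.
  have hs : ∀ u v : V3, u ⬝ᵥ (J *ᵥ v) = (J *ᵥ u) ⬝ᵥ v := fun u v => by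
    rw [Matrix.dotProduct_mulVec, ← Matrix.mulVec_transpose, hJ]
  rw [hs Ω, dotProduct_comm (η' + Ω ⨯₃ η)]
  -- The part Ω × η of δΩ yields the gyroscopic term, by the triple product.
  have ht : (J *ᵥ Ω) ⬝ᵥ (Ω ⨯₃ η) = -((Ω ⨯₃ (J *ᵥ Ω)) ⬝ᵥ η) := by
    rw [← triple_product_permutation, dotProduct_comm, ← cross_anticomm, neg_dotProduct]
  simp only [dotProduct_add, add_dotProduct, ht]
  ring

/-- The acceleration of a point of a rigid body, relative to the mass center. -/
theorem deriv_deriv_mulVec_const {R : ℝ → SO3} (hR : ∀ a b, ContDiff ℝ 2 fun s => (R s : Mat3) a b)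
    (v : V3) (t : ℝ) :
    deriv (deriv fun s => (R s : Mat3) *ᵥ v) t =
      (R t : Mat3) *ᵥ (hat (bodyVel R t) *ᵥ (hat (bodyVel R t) *ᵥ v) +
        hat (deriv (bodyVel R) t) *ᵥ v) := by
  have hd : ∀ t a b, DifferentiableAt ℝ (fun s => (R s : Mat3) a b) t := fun t a b =>
    (hR a b).differentiable two_ne_zero t
  have hΩ : ContDiff ℝ 1 (bodyVel R) :=
    contDiff_slice_left (u := fun _ => bodyVel R) (contDiff_bodyVel_right (R := fun _ => R)
      fun a b => (hR a b).comp contDiff_snd) 0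
  have hh : ∀ a b, DifferentiableAt ℝ (fun s => hat (bodyVel R s) a b) t := by
    have := differentiableAt_pi.1 (hΩ.differentiable one_ne_zero t)
    intro a b
    fin_cases a <;> fin_cases b <;> simp [hat, this]
  have h1 : (deriv fun s => (R s : Mat3) *ᵥ v) =
      fun s => ((R s : Mat3) * hat (bodyVel R s)) *ᵥ v := funext fun s => by
    rw [(hasDerivAt_mulVec_const (hd s) v).deriv, matDeriv_eq_mul_hat_bodyVel (hd s)]
  have h2 : ∀ a b, DifferentiableAt ℝ (fun s => ((R s : Mat3) * hat (bodyVel R s)) a b) t :=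
    differentiableAt_matrix_mul (hd t) hh
  rw [h1, (hasDerivAt_mulVec_const h2 v).deriv, matDeriv_mul (hd t) hh,
    matDeriv_eq_mul_hat_bodyVel (hd t), matDeriv_hat (hΩ.differentiable one_ne_zero t)]
  simp only [Matrix.add_mulVec, Matrix.mulVec_add, Matrix.mulVec_mulVec, Matrix.mul_assoc]

/-- The rotation by the angle `θ` about the `k`-th coordinate axis. -/
noncomputable def axisRotation (k : Fin 3) (θ : ℝ) : SO3 :=
  -- Rodrigues' formula; smoothness in θ and the derivative at 0 can be read off from the sine and
  -- cosine.
  ⟨1 + Real.sin θ • hat (Pi.single k 1) + (1 - Real.cos θ) • hat (Pi.single k 1) ^ 2, by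
    have h := Real.sin_sq_add_cos_sq θ
    rw [Matrix.mem_specialOrthogonalGroup_iff, Matrix.mem_orthogonalGroup_iff]
    constructor
    · ext a b
      fin_cases k <;> fin_cases a <;> fin_cases b <;>
        simp [hat, pow_two, Matrix.mul_apply, Fin.sum_univ_three, Matrix.one_apply] <;>
        linarith
    · fin_cases k <;>
        simp [hat, pow_two, Matrix.det_fin_three] <;> linarith⟩

theorem axisRotation_zero (k : Fin 3) : axisRotation k 0 = 1 := by
  ext1
  simp [axisRotation]

theorem contDiff_axisRotation (k : Fin 3) (a b : Fin 3) :
    ContDiff ℝ 2 fun θ => (axisRotation k θ : Mat3) a b := by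
  simp only [axisRotation, Matrix.add_apply, Matrix.smul_apply, smul_eq_mul]
  exact (contDiff_const.add (Real.contDiff_sin.mul contDiff_const)).add
    ((contDiff_const.sub Real.contDiff_cos).mul contDiff_const)

/-- The factor 1 - cos has zero derivative at angle 0, so only the sine term contributes. -/
theorem matDeriv_axisRotation (k : Fin 3) (r : ℝ) :
    matDeriv (fun ε => (axisRotation k (ε * r) : Mat3)) 0 = r • hat (Pi.single k 1) := by
  ext a b
  have h0 : HasDerivAt (fun ε : ℝ => ε * r) r 0 := by simpa using hasDerivAt_mul_const (x := 0) r
  have h1 := h0.sin.mul_const (hat (Pi.single k 1) a b)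
  have h2 := (h0.cos.const_sub 1).mul_const ((hat (Pi.single k 1) ^ 2) a b)
  have h3 := ((h1.const_add ((1 : Mat3) a b)).add h2).deriv
  simpa [matDeriv, axisRotation, mul_comm, Pi.add_def, add_assoc] using h3

end Rotation

/-! ### Statics and kinematics of a cable -/

/-- Summation along a cable: `p - ∑ uₐ` are the accelerations and `d - ∑ wₐ` the variations of the
bodies of the cable, `F` is the force at its end. -/
theorem cable_sum {N : ℕ} (m : ℝ) (μ : Fin N → ℝ) (p d F : V3) (u w : Fin N → V3) :
    m * ((p - ∑ a, u a) ⬝ᵥ (d - ∑ a, w a))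
        + ∑ j, μ j * ((p - ∑ a ∈ Finset.Ioi j, u a) ⬝ᵥ (d - ∑ a ∈ Finset.Ioi j, w a))
        + F ⬝ᵥ (d - ∑ a, w a) =
      ((∑ j, μ j + m) • p - ∑ a, (m + ∑ b ∈ Finset.Iio a, μ b) • u a + F) ⬝ᵥ d
        - ∑ a, ((m + ∑ b ∈ Finset.Iio a, μ b) • p
            - ∑ k, (m + ∑ b ∈ Finset.Iio (min a k), μ b) • u k + F) ⬝ᵥ w a := by
  -- Link `j` hangs from the payload by the links beyond it, so link `a` carries exactly the masses
  -- with index below `a`.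
  have swap : ∀ g : Fin N → ℝ, ∑ j, μ j * ∑ a ∈ Finset.Ioi j, g a =
      ∑ a, (∑ b ∈ Finset.Iio a, μ b) * g a := fun g => by
    simp only [Finset.mul_sum, Finset.sum_mul]
    exact Finset.sum_comm' (by simp)
  -- Links `a` and `k` both lie beyond `j` exactly when `j < min a k`; this is the origin of the
  -- coupling masses.
  have swap₂ : ∀ g : Fin N → Fin N → ℝ,
      ∑ j, μ j * ∑ a ∈ Finset.Ioi j, ∑ k ∈ Finset.Ioi j, g a k =
      ∑ a, ∑ k, (∑ b ∈ Finset.Iio (min a k), μ b) * g a k := fun g => by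
    simp only [Finset.mul_sum, Finset.sum_mul]
    rw [Finset.sum_comm' (t' := Finset.univ) (s' := fun a => Finset.Iio a) (by simp)]
    refine Finset.sum_congr rfl fun a _ => ?_
    refine Finset.sum_comm' (by simp)
  have e : ∀ s : Finset (Fin N), (p - ∑ a ∈ s, u a) ⬝ᵥ (d - ∑ a ∈ s, w a) =
      p ⬝ᵥ d - ∑ a ∈ s, p ⬝ᵥ w a - ∑ a ∈ s, u a ⬝ᵥ d + ∑ a ∈ s, ∑ k ∈ s, u k ⬝ᵥ w a := fun s => by
    simp only [sub_dotProduct, dotProduct_sub, dotProduct_sum, sum_dotProduct,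
      Finset.sum_sub_distrib]
    ring
  simp only [e, mul_add, mul_sub, Finset.sum_add_distrib, Finset.sum_sub_distrib, swap, swap₂]
  simp only [add_dotProduct, sub_dotProduct, smul_dotProduct, sum_dotProduct, dotProduct_sub,
    dotProduct_sum, smul_eq_mul, Finset.sum_sub_distrib, Finset.sum_add_distrib, add_mul,
    ← Finset.sum_mul, ← Finset.mul_sum]
  ring

section Kinematics

variable {n : ℕ} {nl : Fin n → ℕ}

theorem IsC2.slice_left {γ : ℝ → ℝ → Config n nl} (h : IsC2 fun p : ℝ × ℝ => γ p.1 p.2) (ε : ℝ) :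
    IsC2 (γ ε) where
  R0 a b := contDiff_slice_left (u := fun ε t => ((γ ε t).R0 : Mat3) a b) (h.R0 a b) ε
  x0 := contDiff_slice_left (u := fun ε t => (γ ε t).x0) h.x0 ε
  R i a b := contDiff_slice_left (u := fun ε t => ((γ ε t).R i : Mat3) a b) (h.R i a b) ε
  q i j := contDiff_slice_left (u := fun ε t => ((γ ε t).q i j : V3)) (h.q i j) ε

theorem IsC2.slice_right {γ : ℝ → ℝ → Config n nl} (h : IsC2 fun p : ℝ × ℝ => γ p.1 p.2) (t : ℝ) :
    IsC2 fun ε => γ ε t where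
  R0 a b := contDiff_slice_right (u := fun ε t => ((γ ε t).R0 : Mat3) a b) (h.R0 a b) t
  x0 := contDiff_slice_right (u := fun ε t => (γ ε t).x0) h.x0 t
  R i a b := contDiff_slice_right (u := fun ε t => ((γ ε t).R i : Mat3) a b) (h.R i a b) t
  q i j := contDiff_slice_right (u := fun ε t => ((γ ε t).q i j : V3)) (h.q i j) t

/-- The point of the `i`-th cable that is separated from the payload by the links in `s`. -/
noncomputable def System.cablePoint (S : System n nl) (X : Config n nl) (i : Fin n)
    (s : Finset (Fin (nl i))) : V3 :=
  X.x0 + (X.R0 : Mat3) *ᵥ S.ρ i - ∑ a ∈ s, S.l i a • (X.q i a : V3)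

variable (S : System n nl)

/-- Quadrotors are the case `Finset.univ` and links the case `Finset.Ioi j`, both by definition, so
one computation serves all bodies of a cable. -/
theorem System.contDiff_cablePoint {E : Type*} [NormedAddCommGroup E] [NormedSpace ℝ E]
    {F : E → Config n nl} (h : IsC2 F) (i : Fin n) (s : Finset (Fin (nl i))) :
    ContDiff ℝ 2 fun p => S.cablePoint (F p) i s :=
  (h.x0.add (contDiff_mulVec_const h.R0 _)).sub
    (.sum fun a _ => (h.q i a).const_smul (S.l i a))

variable {c : ℝ → Config n nl}

/-- Applied below with the variation parameter ε as the curve parameter, where the body velocity is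
the η₀ of the payload. -/
theorem System.deriv_cablePoint (h : IsC2 c) (i : Fin n) (s : Finset (Fin (nl i))) (t : ℝ) :
    deriv (fun r => S.cablePoint (c r) i s) t =
      deriv (fun r => (c r).x0) t +
        ((c t).R0 : Mat3) *ᵥ (hat (bodyVel (fun r => (c r).R0) t) *ᵥ S.ρ i) -
        ∑ a ∈ s, S.l i a • deriv (fun r => ((c r).q i a : V3)) t := by
  have hd : ∀ a b, DifferentiableAt ℝ (fun r => ((c r).R0 : Mat3) a b) t := fun a b =>
    (h.R0 a b).differentiable two_ne_zero t
  have h1 := hasDerivAt_mulVec_const hd (S.ρ i)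
  rw [matDeriv_eq_mul_hat_bodyVel hd, ← Matrix.mulVec_mulVec] at h1
  exact (((h.x0.differentiable two_ne_zero t).hasDerivAt.add h1).sub
    (HasDerivAt.fun_sum fun a _ =>
      ((h.q i a).differentiable two_ne_zero t).hasDerivAt.const_smul (S.l i a))).deriv

theorem System.deriv_deriv_cablePoint (h : IsC2 c) (i : Fin n) (s : Finset (Fin (nl i))) (t : ℝ) :
    deriv (deriv fun r => S.cablePoint (c r) i s) t =
      deriv (deriv fun r => (c r).x0) t +
        ((c t).R0 : Mat3) *ᵥ (hat (bodyVel (fun r => (c r).R0) t) *ᵥ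
            (hat (bodyVel (fun r => (c r).R0) t) *ᵥ S.ρ i) +
          hat (deriv (bodyVel fun r => (c r).R0) t) *ᵥ S.ρ i) -
        ∑ a ∈ s, S.l i a • deriv (deriv fun r => ((c r).q i a : V3)) t := by
  have hR : ContDiff ℝ 2 fun r => ((c r).R0 : Mat3) *ᵥ S.ρ i := contDiff_mulVec_const h.R0 _
  have d2 : ∀ {y : ℝ → V3}, ContDiff ℝ 2 y → HasDerivAt (deriv y) (deriv (deriv y) t) t :=
    fun {y} hy => ((contDiff_slice_left (u := fun _ s => deriv y s)
      (contDiff_deriv_right (u := fun _ => y) (hy.comp contDiff_snd)) 0).differentiable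
      one_ne_zero t).hasDerivAt
  have d1 : (deriv fun r => S.cablePoint (c r) i s) = fun r =>
      deriv (fun r => (c r).x0) r + deriv (fun r => ((c r).R0 : Mat3) *ᵥ S.ρ i) r -
        ∑ a ∈ s, S.l i a • deriv (fun r => ((c r).q i a : V3)) r := funext fun r =>
    (((h.x0.differentiable two_ne_zero r).hasDerivAt.add
      (hR.differentiable two_ne_zero r).hasDerivAt).sub (HasDerivAt.fun_sum fun a _ =>
      ((h.q i a).differentiable two_ne_zero r).hasDerivAt.const_smul (S.l i a))).deriv
  rw [d1, ← deriv_deriv_mulVec_const h.R0]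
  exact (((d2 h.x0).add (d2 hR)).sub
    (HasDerivAt.fun_sum fun a _ => (d2 (h.q i a)).const_smul (S.l i a))).deriv

end Kinematics

namespace HasFirstVariation

variable {a b : ℝ} {L : ℝ → ℝ → ℝ} {G G' : ℝ → ℝ}

theorem neg (h : HasFirstVariation a b L G) :
    HasFirstVariation a b (fun ε t => -L ε t) (fun t => -G t) := by
  simpa using h.const_mul (-1)

theorem congr_right (h : HasFirstVariation a b L G) (hG : ∀ t, G t = G' t) :
    HasFirstVariation a b L G' := by
  rwa [← funext hG]

end HasFirstVariation

/-! ### First variation of the Lagrangian and its residual form -/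

namespace System

variable {n : ℕ} {nl : Fin n → ℕ} (S : System n nl)

/-- The integrand of the first variation of the action. -/
noncomputable def eulerLagrangePairing (γ : ℝ → ℝ → Config n nl) (t : ℝ) : ℝ :=
  S.m0 * ((deriv (deriv fun s => (γ 0 s).x0) t - S.g • e3) ⬝ᵥ deriv (fun ε => (γ ε t).x0) 0)
    + ∑ i, ∑ j, S.mL i j * ((deriv (deriv fun s => S.linkPos (γ 0 s) i j) t - S.g • e3) ⬝ᵥ
        deriv (fun ε => S.linkPos (γ ε t) i j) 0)
    + ∑ i, S.m i * ((deriv (deriv fun s => S.quadPos (γ 0 s) i) t - S.g • e3) ⬝ᵥ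
        deriv (fun ε => S.quadPos (γ ε t) i) 0)
    + ∑ i, (S.J i *ᵥ deriv (bodyVel fun s => (γ 0 s).R i) t +
        bodyVel (fun s => (γ 0 s).R i) t ⨯₃ (S.J i *ᵥ bodyVel (fun s => (γ 0 s).R i) t)) ⬝ᵥ
        bodyVel (fun ε => (γ ε t).R i) 0
    + (S.J0 *ᵥ deriv (bodyVel fun s => (γ 0 s).R0) t +
        bodyVel (fun s => (γ 0 s).R0) t ⨯₃ (S.J0 *ᵥ bodyVel (fun s => (γ 0 s).R0) t)) ⬝ᵥ
        bodyVel (fun ε => (γ ε t).R0) 0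

theorem hasFirstVariation_lagrangian (hJ0 : S.J0.IsSymm) (hJ : ∀ i, (S.J i).IsSymm)
    {γ : ℝ → ℝ → Config n nl} (h : IsC2 fun p : ℝ × ℝ => γ p.1 p.2) {t0 tf : ℝ}
    (h0 : ∀ ε, γ ε t0 = γ 0 t0) (hf : ∀ ε, γ ε tf = γ 0 tf) :
    HasFirstVariation t0 tf (fun ε t => S.lagrangian (γ ε) t) (S.eulerLagrangePairing γ) := by
  have hq : ∀ i, ContDiff ℝ 2 fun p : ℝ × ℝ => S.quadPos (γ p.1 p.2) i := fun i =>
    S.contDiff_cablePoint h i Finset.univ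
  have hL : ∀ i j, ContDiff ℝ 2 fun p : ℝ × ℝ => S.linkPos (γ p.1 p.2) i j := fun i j =>
    S.contDiff_cablePoint h i (Finset.Ioi j)
  have T0 := hasFirstVariation_deriv_dotProduct_self (y := fun ε t => (γ ε t).x0) (a := t0)
    (b := tf) h.x0 (fun ε => by rw [h0]) (fun ε => by rw [hf])
  have TL := fun i j => hasFirstVariation_deriv_dotProduct_self
    (y := fun ε t => S.linkPos (γ ε t) i j) (a := t0)
    (b := tf) (hL i j) (fun ε => by rw [h0]) (fun ε => by rw [hf])
  have Tq := fun i => hasFirstVariation_deriv_dotProduct_self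
    (y := fun ε t => S.quadPos (γ ε t) i) (a := t0)
    (b := tf) (hq i) (fun ε => by rw [h0]) (fun ε => by rw [hf])
  have Tr := fun i => hasFirstVariation_rotational (hJ i) (R := fun ε t => (γ ε t).R i) (a := t0)
    (b := tf) (h.R i) (fun ε => by rw [h0]) (fun ε => by rw [hf])
  have Tr0 := hasFirstVariation_rotational hJ0 (R := fun ε t => (γ ε t).R0) (a := t0)
    (b := tf) h.R0 (fun ε => by rw [h0]) (fun ε => by rw [hf])
  have V0 := hasFirstVariation_dotProduct e3 (y := fun ε t => (γ ε t).x0) h.x0 t0 tf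
  have Vq := fun i => hasFirstVariation_dotProduct e3
    (y := fun ε t => S.quadPos (γ ε t) i) (hq i) t0 tf
  have VL := fun i j => hasFirstVariation_dotProduct e3
    (y := fun ε t => S.linkPos (γ ε t) i j) (hL i j) t0 tf
  -- The nesting follows the definitions of `kinetic` and `potential`, so the integrand agrees with
  -- the Lagrangian definitionally and only the variations need algebra.
  have key := (((((T0.const_mul (1 / 2 * S.m0)).add
    (.sum Finset.univ fun i _ => .sum Finset.univ fun j _ =>
      (TL i j).const_mul (1 / 2 * S.mL i j))).add
    ((HasFirstVariation.sum Finset.univ fun i _ => (Tq i).const_mul (S.m i)).const_mul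
      (1 / 2))).add
    ((HasFirstVariation.sum Finset.univ fun i _ => Tr i).const_mul (1 / 2))).add
    (Tr0.const_mul (1 / 2))).sub
    (((V0.const_mul (S.m0 * S.g)).neg.sub
      (.sum Finset.univ fun i _ => (Vq i).const_mul (S.m i * S.g))).sub
      (.sum Finset.univ fun i _ => .sum Finset.univ fun j _ =>
        (VL i j).const_mul (S.mL i j * S.g)))
  refine HasFirstVariation.congr_right (L := fun ε t => S.lagrangian (γ ε) t) key fun t => ?_
  simp only [eulerLagrangePairing, sub_dotProduct, smul_dotProduct, smul_eq_mul, mul_sub,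
    Finset.sum_sub_distrib, ← Finset.mul_sum, mul_neg, Finset.sum_neg_distrib]
  simp only [mul_assoc, mul_left_comm _ (2 : ℝ), ← Finset.mul_sum]
  ring

/-! ### The residuals of the equations of motion -/

/-- Acceleration, less gravity, of the point where the `i`-th cable is attached. -/
noncomputable def attachAccel (c : ℝ → Config n nl) (t : ℝ) (i : Fin n) : V3 :=
  deriv (deriv fun r => (c r).x0) t +
    ((c t).R0 : Mat3) *ᵥ (hat (bodyVel (fun r => (c r).R0) t) *ᵥ
        (hat (bodyVel (fun r => (c r).R0) t) *ᵥ S.ρ i) +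
      hat (deriv (bodyVel fun r => (c r).R0) t) *ᵥ S.ρ i) - S.g • e3

/-- Force of the payload on the `i`-th cable. -/
noncomputable def cableLoad (f : Fin n → ℝ → ℝ) (c : ℝ → Config n nl) (t : ℝ) (i : Fin n) : V3 :=
  S.MiT i • S.attachAccel c t i
    - ∑ a, S.M0 i a • (S.l i a • deriv (deriv fun r => ((c r).q i a : V3)) t)
    + f i t • (((c t).R i : Mat3) *ᵥ e3)

/-- Force along the `j`-th link of the `i`-th cable. -/
noncomputable def linkLoad (f : Fin n → ℝ → ℝ) (c : ℝ → Config n nl) (t : ℝ) (i : Fin n)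
    (j : Fin (nl i)) : V3 :=
  S.M0 i j • S.attachAccel c t i
    - ∑ k, S.M0 i (min j k) • (S.l i k • deriv (deriv fun r => ((c r).q i k : V3)) t)
    + f i t • (((c t).R i : Mat3) *ᵥ e3)

/-- Residual of the equation of translation of the payload. -/
noncomputable def translationResidual (f : Fin n → ℝ → ℝ) (c : ℝ → Config n nl) (t : ℝ) : V3 :=
  S.m0 • (deriv (deriv fun r => (c r).x0) t - S.g • e3) + ∑ i, S.cableLoad f c t i

/-- Residual of the equation of rotation of the payload. -/
noncomputable def rotationResidual (f : Fin n → ℝ → ℝ) (c : ℝ → Config n nl) (t : ℝ) : V3 :=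
  S.J0 *ᵥ deriv (bodyVel fun r => (c r).R0) t +
    bodyVel (fun r => (c r).R0) t ⨯₃ (S.J0 *ᵥ bodyVel (fun r => (c r).R0) t) +
    ∑ i, hat (S.ρ i) *ᵥ (((c t).R0 : Mat3)ᵀ *ᵥ S.cableLoad f c t i)

/-- Residual of the equation of the attitude of the `i`-th quadrotor. -/
noncomputable def attitudeResidual (M : Fin n → ℝ → V3) (c : ℝ → Config n nl) (t : ℝ)
    (i : Fin n) : V3 :=
  S.J i *ᵥ deriv (bodyVel fun r => (c r).R i) t +
    bodyVel (fun r => (c r).R i) t ⨯₃ (S.J i *ᵥ bodyVel (fun r => (c r).R i) t) - M i t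

/-- The residuals, paired with a variation. -/
noncomputable def residualPairing (f : Fin n → ℝ → ℝ) (M : Fin n → ℝ → V3)
    (γ : ℝ → ℝ → Config n nl) (t : ℝ) : ℝ :=
  S.translationResidual f (γ 0) t ⬝ᵥ deriv (fun ε => (γ ε t).x0) 0
    + S.rotationResidual f (γ 0) t ⬝ᵥ bodyVel (fun ε => (γ ε t).R0) 0
    - ∑ i, ∑ j, S.l i j * (S.linkLoad f (γ 0) t i j ⬝ᵥ deriv (fun ε => ((γ ε t).q i j : V3)) 0)
    + ∑ i, S.attitudeResidual M (γ 0) t i ⬝ᵥ bodyVel (fun ε => (γ ε t).R i) 0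

/-- The integrand of the virtual work. -/
noncomputable def virtualPower (f : Fin n → ℝ → ℝ) (M : Fin n → ℝ → V3)
    (γ : ℝ → ℝ → Config n nl) (t : ℝ) : ℝ :=
  ∑ i, ((-(f i t • (((γ 0 t).R i : Mat3) *ᵥ e3))) ⬝ᵥ deriv (fun ε => S.quadPos (γ ε t) i) 0
      + M i t ⬝ᵥ bodyVel (fun ε => (γ ε t).R i) 0)

/-- Moves a rotation variation off its arm: a force Φ acting at the body-fixed arm v has the
body-frame moment v × RᵀΦ. -/
theorem dotProduct_mulVec_hat_mulVec (Φ η v : V3) (R : Mat3) :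
    Φ ⬝ᵥ (R *ᵥ (hat η *ᵥ v)) = (hat v *ᵥ (Rᵀ *ᵥ Φ)) ⬝ᵥ η := by
  rw [Matrix.dotProduct_mulVec, ← Matrix.mulVec_transpose]
  generalize Rᵀ *ᵥ Φ = w
  rw [hat_mulVec, hat_mulVec, triple_product_permutation, dotProduct_comm]

/-- A pointwise identity in t that needs no end-point condition: each cable is rearranged separately
by `cable_sum`, and the results are summed. -/
theorem eulerLagrangePairing_eq (f : Fin n → ℝ → ℝ) (M : Fin n → ℝ → V3)
    {γ : ℝ → ℝ → Config n nl} (h : IsC2 fun p : ℝ × ℝ => γ p.1 p.2) (t : ℝ) :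
    S.eulerLagrangePairing γ t = S.virtualPower f M γ t + S.residualPairing f M γ t := by
  have key : ∀ i, S.m i * ((deriv (deriv fun s => S.quadPos (γ 0 s) i) t - S.g • e3) ⬝ᵥ
        deriv (fun ε => S.quadPos (γ ε t) i) 0)
      + ∑ j, S.mL i j * ((deriv (deriv fun s => S.linkPos (γ 0 s) i j) t - S.g • e3) ⬝ᵥ
        deriv (fun ε => S.linkPos (γ ε t) i j) 0)
      + (f i t • (((γ 0 t).R i : Mat3) *ᵥ e3)) ⬝ᵥ deriv (fun ε => S.quadPos (γ ε t) i) 0 =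
      S.cableLoad f (γ 0) t i ⬝ᵥ deriv (fun ε => (γ ε t).x0) 0
      + (hat (S.ρ i) *ᵥ (((γ 0 t).R0 : Mat3)ᵀ *ᵥ S.cableLoad f (γ 0) t i)) ⬝ᵥ
        bodyVel (fun ε => (γ ε t).R0) 0
      - ∑ j, S.l i j *
        (S.linkLoad f (γ 0) t i j ⬝ᵥ deriv (fun ε => ((γ ε t).q i j : V3)) 0) := fun i => by
    have a2 : ∀ s, deriv (deriv fun r => S.cablePoint (γ 0 r) i s) t - S.g • e3 =
        S.attachAccel (γ 0) t i -
          ∑ a ∈ s, S.l i a • deriv (deriv fun r => ((γ 0 r).q i a : V3)) t := fun s => by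
      rw [S.deriv_deriv_cablePoint (h.slice_left 0), attachAccel]
      abel
    have a1 := fun s => S.deriv_cablePoint (h.slice_right t) i s 0
    have aq2 : deriv (deriv fun s => S.quadPos (γ 0 s) i) t - S.g • e3 = _ := a2 Finset.univ
    have aq1 : deriv (fun ε => S.quadPos (γ ε t) i) 0 = _ := a1 Finset.univ
    have aL2 : ∀ j, deriv (deriv fun s => S.linkPos (γ 0 s) i j) t - S.g • e3 = _ :=
      fun j => a2 (Finset.Ioi j)
    have aL1 : ∀ j, deriv (fun ε => S.linkPos (γ ε t) i j) 0 = _ := fun j => a1 (Finset.Ioi j)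
    simp only [aq2, aq1, aL2, aL1]
    -- Here p is the attachment acceleration less gravity, d is the variation of the attachment
    -- point, and the end force F is the thrust with its sign reversed.
    rw [cable_sum]
    simp only [dotProduct_smul, smul_eq_mul]
    rw [dotProduct_add, ← dotProduct_mulVec_hat_mulVec]
    rfl
  have sum_key := Finset.sum_congr rfl fun i (_ : i ∈ Finset.univ) => key i
  simp only [Finset.sum_add_distrib, Finset.sum_sub_distrib] at sum_key
  simp only [eulerLagrangePairing, virtualPower, residualPairing, translationResidual,
    rotationResidual, attitudeResidual, neg_dotProduct, add_dotProduct _ (∑ i, _), sum_dotProduct,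
    Finset.sum_add_distrib, sub_dotProduct, Finset.sum_neg_distrib, Finset.sum_sub_distrib] at *
  simp only [smul_dotProduct, sub_dotProduct, smul_eq_mul] at *
  linarith

end System

/-! ### Identities of the hat map -/

section HatIdentities

theorem hat_mulVec_comm (v w : V3) : hat v *ᵥ w = -(hat w *ᵥ v) := by
  rw [hat_mulVec, hat_mulVec, cross_anticomm]

theorem hat_sq_mulVec (q w : V3) : hat q ^ 2 *ᵥ w = (q ⬝ᵥ w) • q - (q ⬝ᵥ q) • w := by
  rw [pow_two, ← Matrix.mulVec_mulVec, hat_mulVec, hat_mulVec, cross_cross_eq_smul_sub_smul']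

/-- Both sides equal (v · w) v × w. With v = ρᵢ and w = Ω₀, it turns the moment of the centripetal
acceleration into the contribution of -ρ̂ᵢ² to Ω₀ × J̄₀Ω₀. -/
theorem hat_mulVec_hat_sq_mulVec (v w : V3) :
    hat v *ᵥ (hat w *ᵥ (hat w *ᵥ v)) = -(hat w *ᵥ (hat v ^ 2 *ᵥ w)) := by
  rw [Matrix.mulVec_mulVec v, ← pow_two, hat_sq_mulVec, hat_sq_mulVec]
  simp only [Matrix.mulVec_sub, Matrix.mulVec_smul]
  rw [hat_mulVec v v, hat_mulVec w w, cross_self, cross_self, hat_mulVec_comm v w,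
    dotProduct_comm w v]
  simp

end HatIdentities

namespace System

variable {n : ℕ} {nl : Fin n → ℕ} (S : System n nl) (f : Fin n → ℝ → ℝ) (M : Fin n → ℝ → V3)
  (c : ℝ → Config n nl) (t : ℝ)

/-! ### The equations of motion and their residuals -/

theorem payloadTranslationEq_iff :
    S.PayloadTranslationEq f c t ↔ S.translationResidual f c t = 0 := by
  rw [PayloadTranslationEq, ← sub_eq_zero]
  refine Eq.congr ?_ rfl
  simp only [translationResidual, cableLoad, attachAccel, ← Matrix.mulVec_mulVec, pow_two,
    hat_mulVec_comm (deriv _ t), MT, Matrix.mulVec_add, Matrix.mulVec_neg, smul_add, smul_sub,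
    smul_neg, Finset.sum_add_distrib, Finset.sum_sub_distrib, Finset.sum_neg_distrib, add_smul,
    Finset.sum_smul, mul_smul]
  abel

/-- In the moments of the cable loads R₀ᵀ cancels R₀. The angular acceleration then contributes
-ρ̂ᵢ²Ω̇₀, which completes J₀ to J̄₀. -/
theorem payloadRotationEq_iff :
    S.PayloadRotationEq f c t ↔ S.rotationResidual f c t = 0 := by
  rw [PayloadRotationEq, ← sub_eq_zero]
  refine Eq.congr ?_ rfl
  have hR : ∀ w : V3, ((c t).R0 : Mat3)ᵀ *ᵥ (((c t).R0 : Mat3) *ᵥ w) = w := fun w => by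
    rw [Matrix.mulVec_mulVec, SO3.transpose_mul_self, Matrix.one_mulVec]
  simp only [rotationResidual, cableLoad, attachAccel, ← Matrix.mulVec_mulVec, Jbar0,
    Matrix.mulVec_add, Matrix.mulVec_sub, Matrix.mulVec_neg, Matrix.mulVec_smul, hR,
    Matrix.mulVec_sum, Matrix.sub_mulVec, Matrix.sum_mulVec, Matrix.smul_mulVec,
    hat_mulVec_hat_sq_mulVec, ← hat_mulVec (bodyVel _ t), hat_mulVec_comm (deriv _ t), smul_add,
    smul_sub, smul_neg, Finset.sum_add_distrib, Finset.sum_sub_distrib, Finset.sum_neg_distrib,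
    mul_smul]
  simp only [pow_two, ← Matrix.mulVec_mulVec]
  abel

theorem linkEq_iff (i : Fin n) (j : Fin (nl i)) :
    S.LinkEq f c t i j ↔ hat ((c t).q i j) ^ 2 *ᵥ S.linkLoad f c t i j = 0 := by
  -- The link equation is the projected load with the opposite sign.
  rw [LinkEq, ← sub_eq_zero, ← neg_eq_zero]
  refine Eq.congr ?_ rfl
  simp only [linkLoad, attachAccel, ← Matrix.mulVec_mulVec,
    Matrix.mulVec_add, Matrix.mulVec_sub, Matrix.mulVec_neg, Matrix.mulVec_smul,
    Matrix.mulVec_sum, hat_mulVec_comm (deriv _ t), smul_add, smul_sub, smul_neg, mul_smul]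
  simp only [pow_two (hat (bodyVel _ t)), ← Matrix.mulVec_mulVec]
  abel

theorem quadAttitudeEq_iff (i : Fin n) :
    S.QuadAttitudeEq M c t i ↔ S.attitudeResidual M c t i = 0 := by
  rw [QuadAttitudeEq, attitudeResidual, sub_eq_zero]

/-! ### Continuity of the residuals -/

section Continuity

variable {f M c t} {t0 tf : ℝ}

theorem continuous_deriv_deriv {y : ℝ → V3} (hy : ContDiff ℝ 2 y) :
    Continuous (deriv (deriv y)) := by
  have h1 : ContDiff ℝ 1 (deriv y) := contDiff_slice_left (u := fun _ s => deriv y s)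
      (contDiff_deriv_right (u := fun _ => y) (hy.comp contDiff_snd)) 0
  exact h1.continuous_deriv le_rfl

theorem contDiff_bodyVel {R : ℝ → SO3}
    (hR : ∀ a b, ContDiff ℝ 2 fun s => (R s : Mat3) a b) : ContDiff ℝ 1 (bodyVel R) :=
  contDiff_slice_left (u := fun _ => bodyVel R) (contDiff_bodyVel_right (R := fun _ => R)
    fun a b => (hR a b).comp contDiff_snd) 0

theorem continuous_coe_SO3 {R : ℝ → SO3}
    (hR : ∀ a b, ContDiff ℝ 2 fun s => (R s : Mat3) a b) : Continuous fun s => (R s : Mat3) :=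
  continuous_matrix fun a b => (hR a b).continuous

theorem continuous_hat : Continuous hat :=
  continuous_matrix fun a b => by
    fin_cases a <;> fin_cases b <;> simp [hat] <;> fun_prop

theorem continuous_crossProduct {u v : ℝ → V3} (hu : Continuous u)
    (hv : Continuous v) : Continuous fun s => u s ⨯₃ v s := by
  simp only [← hat_mulVec]
  exact (continuous_hat.comp hu).matrix_mulVec hv

theorem continuousOn_mulVec {A : ℝ → Mat3} {u : ℝ → V3} {s : Set ℝ} (hA : ContinuousOn A s)
    (hu : ContinuousOn u s) : ContinuousOn (fun t => A t *ᵥ u t) s := by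
  have h : Continuous fun p : Mat3 × V3 => p.1 *ᵥ p.2 :=
    continuous_fst.matrix_mulVec continuous_snd
  exact h.comp_continuousOn (hA.prodMk hu)

theorem continuous_attachAccel (hc : IsC2 c) (i : Fin n) : Continuous fun t => S.attachAccel c t i := by
  have hΩ := contDiff_bodyVel hc.R0
  have h1 := continuous_hat.comp hΩ.continuous
  have h2 := continuous_hat.comp (hΩ.continuous_deriv le_rfl)
  exact ((continuous_deriv_deriv hc.x0).add ((continuous_coe_SO3 hc.R0).matrix_mulVec
    ((h1.matrix_mulVec (h1.matrix_mulVec continuous_const)).add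
      (h2.matrix_mulVec continuous_const)))).sub continuous_const

/-- Continuity holds only on the closed time interval, since the thrusts are not assumed continuous
elsewhere; the fundamental lemma asks for no more. -/
theorem continuousOn_cableLoad (hc : IsC2 c) (hf : ∀ i, ContinuousOn (f i) (Set.Icc t0 tf))
    (i : Fin n) :
    ContinuousOn (fun t => S.cableLoad f c t i) (Set.Icc t0 tf) := by
  refine ContinuousOn.add (Continuous.continuousOn ?_) ((hf i).smul
    ((continuous_coe_SO3 (hc.R i)).matrix_mulVec continuous_const).continuousOn)
  exact ((S.continuous_attachAccel hc i).const_smul (S.MiT i)).sub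
    (continuous_finsetSum Finset.univ fun a _ =>
      ((continuous_deriv_deriv (hc.q i a)).const_smul (S.l i a)).const_smul (S.M0 i a))

theorem continuousOn_linkLoad (hc : IsC2 c) (hf : ∀ i, ContinuousOn (f i) (Set.Icc t0 tf))
    (i : Fin n) (j : Fin (nl i)) : ContinuousOn (fun t => S.linkLoad f c t i j) (Set.Icc t0 tf) := by
  refine ContinuousOn.add (Continuous.continuousOn ?_) ((hf i).smul
    ((continuous_coe_SO3 (hc.R i)).matrix_mulVec continuous_const).continuousOn)
  exact ((S.continuous_attachAccel hc i).const_smul (S.M0 i j)).sub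
    (continuous_finsetSum Finset.univ fun a _ =>
      ((continuous_deriv_deriv (hc.q i a)).const_smul (S.l i a)).const_smul (S.M0 i (min j a)))

theorem continuousOn_translationResidual (hc : IsC2 c)
    (hf : ∀ i, ContinuousOn (f i) (Set.Icc t0 tf)) :
    ContinuousOn (S.translationResidual f c) (Set.Icc t0 tf) :=
  (((continuous_deriv_deriv hc.x0).sub (continuous_const (y := S.g • e3))).const_smul
    S.m0).continuousOn.add
    (continuousOn_finsetSum Finset.univ fun i _ => S.continuousOn_cableLoad hc hf i)

theorem continuous_eulerTerm {R : ℝ → SO3} (J : Mat3)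
    (hR : ∀ a b, ContDiff ℝ 2 fun s => (R s : Mat3) a b) :
    Continuous fun t => J *ᵥ deriv (bodyVel R) t + bodyVel R t ⨯₃ (J *ᵥ bodyVel R t) := by
  have hΩ := contDiff_bodyVel hR
  exact (continuous_const.matrix_mulVec (hΩ.continuous_deriv le_rfl)).add
    (continuous_crossProduct hΩ.continuous (continuous_const.matrix_mulVec hΩ.continuous))

theorem continuousOn_rotationResidual (hc : IsC2 c)
    (hf : ∀ i, ContinuousOn (f i) (Set.Icc t0 tf)) :
    ContinuousOn (S.rotationResidual f c) (Set.Icc t0 tf) := by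
  have h : ∀ i, ContinuousOn
      (fun t => hat (S.ρ i) *ᵥ (((c t).R0 : Mat3)ᵀ *ᵥ S.cableLoad f c t i)) (Set.Icc t0 tf) := by
    intro i
    exact continuousOn_mulVec continuousOn_const (continuousOn_mulVec
      (continuous_coe_SO3 hc.R0).matrix_transpose.continuousOn
      (S.continuousOn_cableLoad hc hf i))
  unfold rotationResidual
  exact (continuous_eulerTerm S.J0 hc.R0).continuousOn.add
    (continuousOn_finsetSum Finset.univ fun i _ => h i)

theorem continuousOn_attitudeResidual (hc : IsC2 c)
    (hM : ∀ i, ContinuousOn (M i) (Set.Icc t0 tf)) (i : Fin n) :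
    ContinuousOn (fun t => S.attitudeResidual M c t i) (Set.Icc t0 tf) :=
  (continuous_eulerTerm (S.J i) (hc.R i)).continuousOn.sub (hM i)

end Continuity

end System

/-! ### Test variations by rotations about coordinate axes -/

section AxisVariation

variable {n : ℕ} {nl : Fin n → ℕ}

theorem SO3.mulVec_dotProduct_mulVec (R : SO3) (u v : V3) :
    ((R : Mat3) *ᵥ u) ⬝ᵥ ((R : Mat3) *ᵥ v) = u ⬝ᵥ v := by
  rw [Matrix.dotProduct_mulVec, ← Matrix.mulVec_transpose, Matrix.mulVec_mulVec,
    SO3.transpose_mul_self, Matrix.one_mulVec]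

/-- The variation of the motion `c` that translates the payload along `v` and rotates the payload,
the quadrotors and the links about the `k`-th coordinate axis, with amplitudes that are
proportional to `φ`. -/
noncomputable def axisVariation (c : ℝ → Config n nl) (φ : ℝ → ℝ) (k : Fin 3) (v : V3) (r0 : ℝ)
    (r : Fin n → ℝ) (d : (i : Fin n) → Fin (nl i) → ℝ) (ε t : ℝ) : Config n nl where
  -- Attitudes are perturbed on the right, which makes η a multiple of the k-th basis vector
  -- whatever the attitude; link directions below are rotated from the left, which keeps them on the
  -- sphere.
  R0 := (c t).R0 * axisRotation k (ε * (φ t * r0))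
  x0 := (c t).x0 + (ε * φ t) • v
  R i := (c t).R i * axisRotation k (ε * (φ t * r i))
  q i j := ⟨(axisRotation k (ε * (φ t * d i j)) : Mat3) *ᵥ ((c t).q i j : V3), by
    rw [SO3.mulVec_dotProduct_mulVec]
    exact ((c t).q i j).2⟩

variable {c : ℝ → Config n nl} {φ : ℝ → ℝ} (k : Fin 3) (v : V3) (r0 : ℝ) (r : Fin n → ℝ)
  (d : (i : Fin n) → Fin (nl i) → ℝ)

theorem axisVariation_of_eq_zero {ε t : ℝ} (h : ε * φ t = 0) :
    axisVariation c φ k v r0 r d ε t = c t := by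
  have h' : ∀ x, ε * (φ t * x) = 0 := fun x => by rw [← mul_assoc, h, zero_mul]
  simp [axisVariation, h', h, axisRotation_zero]

theorem contDiff_axisRotation_comp (hφ : ContDiff ℝ 2 φ) (x : ℝ) (a b : Fin 3) :
    ContDiff ℝ 2 fun p : ℝ × ℝ => (axisRotation k (p.1 * (φ p.2 * x)) : Mat3) a b :=
  (contDiff_axisRotation k a b).comp
    (contDiff_fst.mul ((hφ.comp contDiff_snd).mul contDiff_const))

theorem contDiff_mul_axisRotation {R : ℝ → SO3}
    (hR : ∀ a b, ContDiff ℝ 2 fun s => (R s : Mat3) a b) (hφ : ContDiff ℝ 2 φ) (x : ℝ)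
    (a b : Fin 3) :
    ContDiff ℝ 2 fun p : ℝ × ℝ => ((R p.2 * axisRotation k (p.1 * (φ p.2 * x)) : SO3) : Mat3) a b
    := by
  simp only [Submonoid.coe_mul, Matrix.mul_apply]
  exact .sum fun l _ => ((hR a l).comp contDiff_snd).mul (contDiff_axisRotation_comp k hφ x l b)

theorem isVariation_axisVariation (hc : IsC2 c) (hφ : ContDiff ℝ 2 φ) {t0 tf : ℝ}
    (h0 : φ t0 = 0) (hf : φ tf = 0) :
    IsVariation t0 tf c (axisVariation c φ k v r0 r d) where
  isC2 :=
    { R0 := contDiff_mul_axisRotation k hc.R0 hφ r0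
      x0 := (hc.x0.comp contDiff_snd).add
        ((contDiff_fst.mul (hφ.comp contDiff_snd)).smul contDiff_const)
      R := fun i => contDiff_mul_axisRotation k (hc.R i) hφ (r i)
      q := fun i j => contDiff_pi.2 fun a => ContDiff.sum (s := Finset.univ) fun b _ =>
        (contDiff_axisRotation_comp k hφ (d i j) a b).mul
          ((contDiff_pi.1 (hc.q i j) b).comp contDiff_snd) }
  zero := funext fun _ => axisVariation_of_eq_zero k v r0 r d (zero_mul _)
  left ε := axisVariation_of_eq_zero k v r0 r d (by rw [h0, mul_zero])
  right ε := axisVariation_of_eq_zero k v r0 r d (by rw [hf, mul_zero])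

theorem differentiableAt_axisRotation (x : ℝ) (a b : Fin 3) :
    DifferentiableAt ℝ (fun ε => (axisRotation k (ε * x) : Mat3) a b) 0 :=
  (((contDiff_axisRotation k a b).comp (contDiff_id.mul contDiff_const)).differentiable
    two_ne_zero) 0

theorem bodyVel_mul_axisRotation (R : SO3) (x : ℝ) :
    bodyVel (fun ε => R * axisRotation k (ε * x)) 0 = x • Pi.single k 1 := by
  have h := matDeriv_mul (A := fun _ => (R : Mat3)) (fun _ _ => differentiableAt_const _)
    (differentiableAt_axisRotation k x)
  have h0 : matDeriv (fun _ => (R : Mat3)) 0 = 0 := by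
    ext a b
    simp [matDeriv]
  rw [h0, Matrix.zero_mul, zero_add, matDeriv_axisRotation] at h
  simp only [bodyVel, Submonoid.coe_mul, zero_mul, axisRotation_zero, OneMemClass.coe_one,
    Matrix.mul_one]
  rw [h, ← Matrix.mul_assoc, SO3.transpose_mul_self, Matrix.one_mul]
  ext a
  fin_cases a <;> simp [vee, hat]

theorem deriv_axisRotation_mulVec (x : ℝ) (w : V3) :
    deriv (fun ε => (axisRotation k (ε * x) : Mat3) *ᵥ w) 0 = x • (Pi.single k 1 ⨯₃ w) := by
  rw [(hasDerivAt_mulVec_const (differentiableAt_axisRotation k x) w).deriv,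
    matDeriv_axisRotation, Matrix.smul_mulVec, hat_mulVec]

end AxisVariation

namespace System

variable {n : ℕ} {nl : Fin n → ℕ} (S : System n nl) {f : Fin n → ℝ → ℝ} {M : Fin n → ℝ → V3}
  {c : ℝ → Config n nl} {t0 tf : ℝ}

/-- Every infinitesimal variation is proportional to φ(t), so φ factors out. For a link, δq is a
multiple of e_k × q, and the triple product yields the k-th component of q × load. -/
theorem residualPairing_axisVariation (φ : ℝ → ℝ) (k : Fin 3) (v : V3) (r0 : ℝ) (r : Fin n → ℝ)
    (d : (i : Fin n) → Fin (nl i) → ℝ) (t : ℝ) :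
    S.residualPairing f M (axisVariation c φ k v r0 r d) t =
      φ t * (S.translationResidual f c t ⬝ᵥ v + r0 * S.rotationResidual f c t k
        - ∑ i, ∑ j, S.l i j * d i j * (((c t).q i j : V3) ⨯₃ S.linkLoad f c t i j) k
        + ∑ i, r i * S.attitudeResidual M c t i k) := by
  have hz : axisVariation c φ k v r0 r d 0 = c :=
    funext fun _ => axisVariation_of_eq_zero k v r0 r d (zero_mul _)
  have hx : deriv (fun ε => (axisVariation c φ k v r0 r d ε t).x0) 0 = φ t • v := by
    have h := (((hasDerivAt_id (0 : ℝ)).mul_const (φ t)).smul_const v).const_add (c t).x0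
    rw [one_mul] at h
    exact h.deriv
  have h0 : bodyVel (fun ε => (axisVariation c φ k v r0 r d ε t).R0) 0 = _ :=
    bodyVel_mul_axisRotation k (c t).R0 (φ t * r0)
  have hR : ∀ i, bodyVel (fun ε => (axisVariation c φ k v r0 r d ε t).R i) 0 = _ := fun i =>
    bodyVel_mul_axisRotation k ((c t).R i) (φ t * r i)
  have hq : ∀ i j, deriv (fun ε => ((axisVariation c φ k v r0 r d ε t).q i j : V3)) 0 = _ :=
    fun i j => deriv_axisRotation_mulVec k (φ t * d i j) ((c t).q i j)
  have ht : ∀ u w : V3, u ⬝ᵥ (Pi.single k 1 ⨯₃ w) = (w ⨯₃ u) k := fun u w => by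
    rw [triple_product_permutation, single_dotProduct, one_mul]
  simp only [residualPairing, hz, hx, h0, hR, hq, dotProduct_smul, ht, dotProduct_single, mul_one,
    smul_eq_mul, mul_add, mul_sub, Finset.mul_sum, mul_assoc, mul_left_comm (φ t)]

theorem hasFirstVariation_action_of_isVariation (hJ0 : S.J0.IsSymm) (hJ : ∀ i, (S.J i).IsSymm)
    {γ : ℝ → ℝ → Config n nl} (hγ : IsVariation t0 tf c γ) :
    HasFirstVariation t0 tf (fun ε t => S.lagrangian (γ ε) t) (S.eulerLagrangePairing γ) :=
  S.hasFirstVariation_lagrangian hJ0 hJ hγ.isC2 (fun ε => by rw [hγ.left, hγ.left])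
    (fun ε => by rw [hγ.right, hγ.right])

/-- For a unit vector, q̂² = qqᵀ - I is minus the projection to the tangent plane, so its kernel is
the line through q. -/
theorem hat_sq_mulVec_eq_zero_iff {q w : V3} (hq : q ⬝ᵥ q = 1) :
    hat q ^ 2 *ᵥ w = 0 ↔ w = (q ⬝ᵥ w) • q := by
  rw [hat_sq_mulVec, hq, one_smul, sub_eq_zero, eq_comm]

theorem residualPairing_eq_zero {γ : ℝ → ℝ → Config n nl} (hγ : IsVariation t0 tf c γ) {t : ℝ}
    (h1 : S.translationResidual f c t = 0) (h2 : S.rotationResidual f c t = 0)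
    (h3 : ∀ i j, hat ((c t).q i j) ^ 2 *ᵥ S.linkLoad f c t i j = 0)
    (h4 : ∀ i, S.attitudeResidual M c t i = 0) : S.residualPairing f M γ t = 0 := by
  have hq : ∀ i j, S.linkLoad f c t i j ⬝ᵥ deriv (fun ε => ((γ ε t).q i j : V3)) 0 = 0 := by
    intro i j
    have hd := (((hγ.isC2.slice_right t).q i j).differentiable two_ne_zero 0).hasDerivAt
    -- Differentiating q · q = 1 in ε gives q ⟂ δq, while the load is parallel to q.
    have hdd := hasDerivAt_dotProduct hd hd
    simp only [fun ε => ((γ ε t).q i j).2] at hdd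
    have h0 := hdd.unique (hasDerivAt_const 0 (1 : ℝ))
    rw [hγ.zero, dotProduct_comm] at h0
    rw [(hat_sq_mulVec_eq_zero_iff ((c t).q i j).2).1 (h3 i j), smul_dotProduct]
    have : ((c t).q i j : V3) ⬝ᵥ deriv (fun ε => ((γ ε t).q i j : V3)) 0 = 0 := by linarith
    rw [this, smul_zero]
  simp [residualPairing, hγ.zero, h1, h2, h4, hq]

theorem lagrangeDAlembert_iff (hJ0 : S.J0.IsSymm) (hJ : ∀ i, (S.J i).IsSymm)
    (hl : ∀ i j, 0 < S.l i j) (ht : t0 < tf)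
    (hf : ∀ i, ContinuousOn (f i) (Set.Icc t0 tf)) (hM : ∀ i, ContinuousOn (M i) (Set.Icc t0 tf))
    (hc : IsC2 c) :
    S.LagrangeDAlembert f M t0 tf c ↔ ∀ t ∈ Set.Icc t0 tf,
      S.translationResidual f c t = 0 ∧ S.rotationResidual f c t = 0 ∧
        (∀ i j, hat ((c t).q i j) ^ 2 *ᵥ S.linkLoad f c t i j = 0) ∧
        ∀ i, S.attitudeResidual M c t i = 0 := by
  constructor
  · intro h
    have key : ∀ (k : Fin 3) (v : V3) (r0 : ℝ) (r : Fin n → ℝ)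
        (d : (i : Fin n) → Fin (nl i) → ℝ), ∀ t ∈ Set.Icc t0 tf,
        S.translationResidual f c t ⬝ᵥ v + r0 * S.rotationResidual f c t k
          - ∑ i, ∑ j, S.l i j * d i j * (((c t).q i j : V3) ⨯₃ S.linkLoad f c t i j) k
          + ∑ i, r i * S.attitudeResidual M c t i k = 0 := by
      intro k v r0 r d
      have hg : ContinuousOn (fun t =>
          S.translationResidual f c t ⬝ᵥ v + r0 * S.rotationResidual f c t k
          - ∑ i, ∑ j, S.l i j * d i j * (((c t).q i j : V3) ⨯₃ S.linkLoad f c t i j) k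
          + ∑ i, r i * S.attitudeResidual M c t i k) (Set.Icc t0 tf) := by
        have hk : ∀ {u : ℝ → V3}, ContinuousOn u (Set.Icc t0 tf) →
            ContinuousOn (fun t => u t k) (Set.Icc t0 tf) := fun hu => continuousOn_pi.1 hu k
        refine ((ContinuousOn.add ?_ ?_).sub ?_).add ?_
        · exact continuousOn_finsetSum _ fun a _ =>
            (continuousOn_pi.1 (S.continuousOn_translationResidual hc hf) a).mul
              continuousOn_const
        · exact continuousOn_const.mul (hk (S.continuousOn_rotationResidual hc hf))
        · refine continuousOn_finsetSum _ fun i _ => continuousOn_finsetSum _ fun j _ =>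
            continuousOn_const.mul (hk ?_)
          simp only [← hat_mulVec]
          exact continuousOn_mulVec (continuous_hat.comp (hc.q i j).continuous).continuousOn
            (S.continuousOn_linkLoad hc hf i j)
        · exact continuousOn_finsetSum _ fun i _ =>
            continuousOn_const.mul (hk (S.continuousOn_attitudeResidual hc hM i))
      refine eq_zero_of_forall_integral_mul_eq_zero ht hg fun φ hφ h0 h1 => ?_
      have hγ := isVariation_axisVariation k v r0 r d hc hφ h0 h1
      have hv := S.hasFirstVariation_action_of_isVariation hJ0 hJ hγ
      -- The derivative of the action exists in any case; uniqueness equates the two expressions for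
      -- it.
      have he := neg_injective (hv.hasDerivAt.unique (h _ hγ))
      have hR : IntervalIntegrable (S.residualPairing f M (axisVariation c φ k v r0 r d))
          volume t0 tf := by
        refine ContinuousOn.intervalIntegrable ?_
        rw [Set.uIcc_of_le ht.le, funext (S.residualPairing_axisVariation φ k v r0 r d)]
        exact hφ.continuous.continuousOn.mul hg
      -- The virtual work is the Euler–Lagrange pairing minus the residual pairing, both integrable,
      -- so the integral of the residual pairing must vanish.
      have hW : S.virtualWork f M t0 tf (axisVariation c φ k v r0 r d) =
          ∫ t in t0..tf, (S.eulerLagrangePairing (axisVariation c φ k v r0 r d) t -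
            S.residualPairing f M (axisVariation c φ k v r0 r d) t) := by
        refine intervalIntegral.integral_congr fun t _ => ?_
        rw [S.eulerLagrangePairing_eq f M hγ.isC2]
        exact (add_sub_cancel_right _ _).symm
      rw [hW, intervalIntegral.integral_sub (hv.continuous_right.intervalIntegrable _ _) hR] at he
      simp only [← S.residualPairing_axisVariation]
      linarith
    intro t hT
    refine ⟨?_, ?_, fun i j => ?_, fun i => ?_⟩
    -- Translating along the value of the residual at the given time makes the pairing its squared
    -- norm; the axis is immaterial.
    · have := key 0 (S.translationResidual f c t) 0 0 0 t hT
      simpa using this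
    · ext k
      simpa using key k 0 1 0 0 t hT
    -- Rotating this link alone about each axis gives l q × load = 0; the positive length cancels,
    -- and a further q × gives the link equation.
    · have hx : ((c t).q i j : V3) ⨯₃ S.linkLoad f c t i j = 0 := by
        ext k
        have := key k 0 0 0 (Pi.single i (Pi.single j 1)) t hT
        rw [Finset.sum_eq_single i (fun i' _ hi => by simp [hi]) (by simp)] at this
        rw [Finset.sum_eq_single j (fun j' _ hj => by simp [hj]) (by simp)] at this
        simpa [(hl i j).ne'] using this
      rw [pow_two, ← Matrix.mulVec_mulVec, hat_mulVec _ (S.linkLoad f c t i j), hx,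
        Matrix.mulVec_zero]
    · ext k
      have := key k 0 0 (Pi.single i 1) 0 t hT
      simpa [Pi.single_apply] using this
  · intro h γ hγ
    have hv := (S.hasFirstVariation_action_of_isVariation hJ0 hJ hγ).hasDerivAt
    have hW : S.virtualWork f M t0 tf γ = ∫ t in t0..tf, S.eulerLagrangePairing γ t := by
      refine intervalIntegral.integral_congr fun t hT => ?_
      rw [Set.uIcc_of_le ht.le] at hT
      obtain ⟨h1, h2, h3, h4⟩ := h t hT
      rw [S.eulerLagrangePairing_eq f M hγ.isC2, S.residualPairing_eq_zero hγ h1 h2 h3 h4,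
        add_zero]
      rfl
    rw [hW]
    exact hv

end System

/-! ### The matrix form -/

namespace System

variable {n : ℕ} {nl : Fin n → ℕ} (S : System n nl)

theorem card_idx (nl : Fin n → ℕ) : Fintype.card (Idx nl) = 6 + 3 * ∑ i, nl i := by
  simp only [Idx, Fintype.card_sum, Fintype.card_sigma, Fintype.card_prod, Fintype.card_fin,
    ← Finset.sum_mul]
  omega

theorem of_mulVec_sigma (B : (i : Fin n) → Fin (nl i) → Mat3) (v : (i : Fin n) → Fin (nl i) → V3) :
    (Matrix.of fun a (p : (i : Fin n) × (Fin (nl i) × Fin 3)) => B p.1 p.2.1 a p.2.2) *ᵥ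
      (fun p => v p.1 p.2.1 p.2.2) = ∑ i, ∑ j, B i j *ᵥ v i j := by
  ext a
  simp only [Matrix.mulVec, dotProduct, Matrix.of_apply, Finset.sum_apply, Fintype.sum_sigma,
    Fintype.sum_prod_type]

theorem blockDiagonal'_mulVec_apply
    (A : (i : Fin n) → Matrix (Fin (nl i) × Fin 3) (Fin (nl i) × Fin 3) ℝ)
    (v : (i : Fin n) → Fin (nl i) → V3) (i : Fin n) (j : Fin (nl i)) (a : Fin 3) :
    (Matrix.blockDiagonal' A *ᵥ fun p => v p.1 p.2.1 p.2.2) ⟨i, j, a⟩ =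
      ∑ k, ∑ b, A i (j, a) (k, b) * v i k b := by
  simp only [Matrix.mulVec, dotProduct, Fintype.sum_sigma]
  rw [Finset.sum_eq_single i, Fintype.sum_prod_type]
  · simp [Matrix.blockDiagonal'_apply_eq]
  · intro i' _ hi
    exact Finset.sum_eq_zero fun p _ => by
      rw [Matrix.blockDiagonal'_apply_ne _ _ _ hi.symm, zero_mul]
  · simp

/-- Differentiating |q|² = 1 twice gives q · q̈ = -|q̇|², to be inserted in q̂²q̈ = (q · q̈)q - q̈.
-/
theorem hat_sq_mulVec_deriv_deriv {q : ℝ → S2} (hq : ContDiff ℝ 2 fun s => (q s : V3)) (t : ℝ) :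
    hat (q t) ^ 2 *ᵥ deriv (deriv fun s => (q s : V3)) t =
      -((deriv (fun s => (q s : V3)) t ⬝ᵥ deriv (fun s => (q s : V3)) t) • (q t : V3)) -
        deriv (deriv fun s => (q s : V3)) t := by
  have d1 : ∀ s, HasDerivAt (fun s => (q s : V3)) (deriv (fun s => (q s : V3)) s) s := fun s =>
    (hq.differentiable two_ne_zero s).hasDerivAt
  have h1 : ContDiff ℝ 1 (deriv fun s => (q s : V3)) :=
    contDiff_slice_left (u := fun _ => deriv fun s => (q s : V3))
      (contDiff_deriv_right (u := fun _ s => (q s : V3)) (hq.comp contDiff_snd)) 0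
  have d2 := (h1.differentiable one_ne_zero t).hasDerivAt
  have e1 : ∀ s, (q s : V3) ⬝ᵥ deriv (fun s => (q s : V3)) s = 0 := fun s => by
    have h := hasDerivAt_dotProduct (d1 s) (d1 s)
    simp only [fun s => (q s).2] at h
    have h0 := h.unique (hasDerivAt_const s (1 : ℝ))
    rw [dotProduct_comm] at h0
    linarith
  have e2 : (q t : V3) ⬝ᵥ deriv (deriv fun s => (q s : V3)) t =
      -(deriv (fun s => (q s : V3)) t ⬝ᵥ deriv (fun s => (q s : V3)) t) := by
    have h := hasDerivAt_dotProduct (d1 t) d2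
    simp only [e1] at h
    linarith [h.unique (hasDerivAt_const t (0 : ℝ))]
  rw [hat_sq_mulVec, (q t).2, e2, neg_smul, one_smul]

/-- Off the diagonal the blocks are those of the link equation. On the diagonal `min j j = j`, and
replacing q̂² by -I adds a multiple of q, by `hv`. -/
theorem sum_Nqq_mulVec (X : Config n nl) (i : Fin n) (j : Fin (nl i))
    (v : Fin (nl i) → V3) (s : ℝ)
    (hv : hat (X.q i j) ^ 2 *ᵥ v j = -(s • (X.q i j : V3)) - v j) (a : Fin 3) :
    ∑ k, ∑ b, S.Nqq X i (j, a) (k, b) * v k b =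
      (∑ k, (S.M0 i (min j k) * S.l i k) • (hat (X.q i j) ^ 2 *ᵥ v k)
        + (S.M0 i j * S.l i j * s) • (X.q i j : V3) : V3) a := by
  have h : ∀ k, ∑ b, S.Nqq X i (j, a) (k, b) * v k b =
      ((S.M0 i (min j k) * S.l i k) • (hat (X.q i j) ^ 2 *ᵥ v k) +
        if j = k then (S.M0 i j * S.l i j * s) • (X.q i j : V3) else 0 : V3) a := fun k => by
    change ((if j = k then -((S.M0 i j * S.l i j) • (1 : Mat3))
      else (S.M0 i (min j k) * S.l i k) • hat (X.q i j) ^ 2) *ᵥ v k) a = _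
    split_ifs with hjk
    · subst hjk
      rw [hv, min_self, Matrix.neg_mulVec, Matrix.smul_mulVec, Matrix.one_mulVec, smul_sub,
        smul_neg, smul_smul]
      simp only [Pi.add_apply, Pi.sub_apply, Pi.neg_apply]
      ring
    · rw [add_zero, Matrix.smul_mulVec]
  simp only [h]
  rw [← Finset.sum_apply, Finset.sum_add_distrib, Finset.sum_ite_eq, if_pos (Finset.mem_univ j)]

theorem sum_elim_eq_iff {α β γ : Type*} {u u' : α → γ} {w w' : β → γ} :
    Sum.elim u w = Sum.elim u' w' ↔ u = u' ∧ w = w' :=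
  ⟨fun h => ⟨funext fun a => congrFun h (.inl a), funext fun b => congrFun h (.inr b)⟩,
    fun h => by rw [h.1, h.2]⟩

theorem sigma_prod_ext_iff {u w : (i : Fin n) → Fin (nl i) → V3} :
    ((fun p : (i : Fin n) × (Fin (nl i) × Fin 3) => u p.1 p.2.1 p.2.2) =
      fun p => w p.1 p.2.1 p.2.2) ↔ ∀ i j, u i j = w i j :=
  ⟨fun h i j => funext fun a => congrFun h ⟨i, j, a⟩, fun h => by simp only [h]⟩

theorem matrixForm_iff (f : Fin n → ℝ → ℝ) {c : ℝ → Config n nl} (hc : IsC2 c) (t : ℝ) :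
    (S.PayloadTranslationEq f c t ∧ S.PayloadRotationEq f c t ∧ ∀ i j, S.LinkEq f c t i j) ↔
      S.N (c t) *ᵥ accel c t = S.P (c t) (bodyVel (fun s => (c s).R0) t)
        (fun i j => deriv (fun s => ((c s).q i j : V3)) t) (fun i => f i t) := by
  set ddx := deriv (deriv fun s => (c s).x0) t with hddx
  set dΩ := deriv (bodyVel fun s => (c s).R0) t with hdΩ
  set ddq : (i : Fin n) → Fin (nl i) → V3 :=
    fun i j => deriv (deriv fun s => ((c s).q i j : V3)) t with hddq
  -- The link row of N times the accelerations: the left side of the link equation plus the |q̇|²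
  -- term, which also occurs in P and cancels at the end.
  let row : (i : Fin n) → Fin (nl i) → V3 := fun i j =>
    (-(S.M0 i j • hat ((c t).q i j) ^ 2)) *ᵥ ddx +
      ((S.M0 i j • (hat ((c t).q i j) ^ 2 * ((c t).R0 : Mat3) * hat (S.ρ i))) *ᵥ dΩ +
      (∑ k, (S.M0 i (min j k) * S.l i k) • (hat ((c t).q i j) ^ 2 *ᵥ ddq i k)
        + (S.M0 i j * S.l i j * (deriv (fun s => ((c s).q i j : V3)) t ⬝ᵥ
            deriv (fun s => ((c s).q i j : V3)) t)) • ((c t).q i j : V3)))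
  have hN : S.N (c t) *ᵥ accel c t =
      Sum.elim ((S.MT • (1 : Mat3)) *ᵥ ddx + (S.NxΩ (c t) *ᵥ dΩ +
          ∑ i, ∑ j, (-((S.M0 i j * S.l i j) • (1 : Mat3))) *ᵥ ddq i j))
        (Sum.elim (S.NΩx (c t) *ᵥ ddx + (S.Jbar0 *ᵥ dΩ + ∑ i, ∑ j,
            (-((S.M0 i j * S.l i j) • (hat (S.ρ i) * ((c t).R0 : Mat3)ᵀ))) *ᵥ ddq i j))
          fun p => row p.1 p.2.1 p.2.2) := by
    rw [N, accel, Matrix.fromRows_mulVec, Matrix.fromRows_mulVec, Matrix.fromCols_mulVec_sumElim,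
      Matrix.fromCols_mulVec_sumElim, Matrix.fromCols_mulVec_sumElim,
      Matrix.fromCols_mulVec_sumElim, Matrix.fromCols_mulVec_sumElim,
      Matrix.fromCols_mulVec_sumElim]
    congr 1
    · rw [← of_mulVec_sigma]
      rfl
    · congr 1
      · rw [← of_mulVec_sigma]
        rfl
      · ext ⟨i, j, a⟩
        rw [Pi.add_apply, Pi.add_apply, blockDiagonal'_mulVec_apply _ ddq,
          sum_Nqq_mulVec S (c t) i j _ _ (hat_sq_mulVec_deriv_deriv (hc.q i j) t)]
        rfl
  rw [hN, P, sum_elim_eq_iff, sum_elim_eq_iff,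
    sigma_prod_ext_iff (u := row) (w := fun i j => S.Pq (c t) (bodyVel (fun s => (c s).R0) t)
      (fun i => f i t) i j (deriv (fun s => ((c s).q i j : V3)) t))]
  refine and_congr ?_ (and_congr ?_ (forall_congr' fun i => forall_congr' fun j => ?_))
  · refine Eq.congr ?_ rfl
    simp only [NxΩ, Matrix.neg_mulVec, Matrix.sum_mulVec, Matrix.smul_mulVec, Matrix.one_mulVec,
      Finset.sum_neg_distrib]
    abel
  · refine Eq.congr ?_ ?_
    -- Skewness of ρ̂ gives -(R₀ρ̂)ᵀ = ρ̂R₀ᵀ, the sign in the rotation equation.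
    · simp only [NΩx, NxΩ, Matrix.transpose_neg, Matrix.transpose_sum, Matrix.transpose_smul,
        Matrix.transpose_mul, hat_transpose, Matrix.neg_mul, Matrix.neg_mulVec, Matrix.sum_mulVec,
        Matrix.smul_mulVec, Finset.sum_neg_distrib, smul_neg, neg_neg]
      abel
    · rw [PΩ, sub_eq_neg_add]
      simp only [sub_eq_neg_add]
  · rw [LinkEq, ← sub_eq_zero, ← sub_eq_zero (a := (_ : V3) + _)]
    refine Eq.congr ?_ rfl
    simp only [Pq, Matrix.neg_mulVec, Matrix.smul_mulVec, sub_eq_neg_add]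
    abel

end System

end CableTransport

theorem proposition1 {n : ℕ} {nl : Fin n → ℕ} (S : CableTransport.System n nl)
    (hJ0 : S.J0.IsSymm) (hJ : ∀ i, (S.J i).IsSymm) (hl : ∀ i j, 0 < S.l i j)
    (t0 tf : ℝ) (ht : t0 < tf)
    (f : Fin n → ℝ → ℝ) (M : Fin n → ℝ → CableTransport.V3)
    (hf : ∀ i, ContinuousOn (f i) (Set.Icc t0 tf)) (hM : ∀ i, ContinuousOn (M i) (Set.Icc t0 tf))
    (c : ℝ → CableTransport.Config n nl) (hc : CableTransport.IsC2 c) :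
    (S.LagrangeDAlembert f M t0 tf c ↔
      ∀ t ∈ Set.Icc t0 tf,
        S.PayloadTranslationEq f c t ∧ S.PayloadRotationEq f c t ∧
          (∀ i j, S.LinkEq f c t i j) ∧ ∀ i, S.QuadAttitudeEq M c t i) ∧
    (∀ t ∈ Set.Icc t0 tf,
      (S.PayloadTranslationEq f c t ∧ S.PayloadRotationEq f c t ∧ ∀ i j, S.LinkEq f c t i j) ↔
        S.N (c t) *ᵥ CableTransport.accel c t =
          S.P (c t) (CableTransport.bodyVel (fun s => (c s).R0) t)
            (fun i j => deriv (fun s => ((c s).q i j : CableTransport.V3)) t) (fun i => f i t)) ∧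
    Fintype.card (CableTransport.System.Idx nl) = 6 + 3 * ∑ i, nl i := by
  refine ⟨?_, fun t _ => S.matrixForm_iff f hc t, CableTransport.System.card_idx nl⟩
  rw [S.lagrangeDAlembert_iff hJ0 hJ hl ht hf hM hc]
  simp only [S.payloadTranslationEq_iff, S.payloadRotationEq_iff, S.linkEq_iff,
    S.quadAttitudeEq_iff]
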